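/- **Setting.** Let $H$ be a separable complex Hilbert space with a complex conjugation $J$ (an antilinear isometric involution; equivalently, $H$ is the complexification of a real separable Hilbert space). Let $(\cdot,\cdot)$ be the inner product, linear in the first argument, and let $\langle f,g\rangle:=(f,Jg)$, a bilinear form; the same notation is used on $H^{\otimes 2}$ with the conjugation $J\otimes J$. All tensor powers are Hilbert space tensor powers, $H^{\otimes 0}=\mathbb C$, $\Omega=1\in H^{\otimes 0}$. Let $T\in\mathcal L(H^{\otimes 2})$ be self-adjoint with $\|T\|\le 1$ and $$(T\otimes \mathbf 1)(\mathbf 1\otimes T)(T\otimes \mathbf 1)=(\mathbf 1\otimes T)(T\otimes \mathbf 1)(\mathbf 1\otimes T)\quad\text{on }H^{\otimes 3}.$$ On $H^{\otimes n}$ put $T_i:=\mathbf 1_{H^{\otimes(i-1)}}\otimes T\otimes\mathbf 1_{H^{\otimes(n-i-1)}}$, $1\le i\le n-1$. For $\sigma\in S_n$ let $T_\sigma:=T_{j_1}\cdots T_{j_m}$, where $\sigma=\sigma_{j_1}\cdots\sigma_{j_m}$ is a reduced expression of $\sigma$ through the transpositions $\sigma_j=(j,j+1)$. Put $\mathcal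 P_n:=\sum_{\sigma\in S_n}T_\sigma$ and $\mathcal F_n(H):=\ker(\mathcal P_n)^\perp\subset H^{\otimes n}$, with the inner product $(f,g)_{\mathcal F_n(H)}:=(\mathcal P_nf,g)$. Let $\mathbb P_n$ be the orthogonal projection of $H^{\otimes n}$ onto $\mathcal F_n(H)$. Let $\mathcal F_{\mathrm{fin}}(H)$ be the space of finite sequences $(f^{(n)})_{n\ge0}$, $f^{(n)}\in\mathcal F_n(H)$, with the inner product of the orthogonal sum of the $\mathcal F_n(H)$. For $f\in H$, the creation operator on $\mathcal F_{\mathrm{fin}}(H)$ is given by $a^+(f)g^{(n)}:=\mathbb P_{n+1}(f\otimes g^{(n)})$ for $g^{(n)}\in\mathcal F_n(H)$, and the annihilation operator is $a^-(f):=a^+(Jf)^*\restriction\mathcal F_{\mathrm{fin}}(H)$. For $f^{(2)}\in H^{\otimes 2}$ and $g^{(n)}\in\mathcal F_n(H)$ put $$a^{++}(f^{(2)})g^{(n)}:=\mathbb P_{n+2}(f^{(2)}\otimes g^{(n)}),$$ $$a^{+-}(f^{(2)})g^{(n)}:=\mathbb P_n\big(\langle f^{(2)},\cdot\rangle_2\otimes\mathbf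 1_{H^{\otimes(n-1)}}\big)\mathbb T_ng^{(n)}\ (n\ge1),\qquad a^{+-}(f^{(2)})\Omega:=0,$$ $$a^{--}(f^{(2)})g^{(n)}:=\mathbb P_{n-2}\,l^{--}(f^{(2)})\big(\mathbf 1_H\otimes(\mathbb T_{n-1}\mathbb P_{n-1})\big)\mathbb T_ng^{(n)}\ (n\ge2),\qquad a^{--}(f^{(2)})g^{(n)}:=0\ (n\le1),$$ where $\mathbb T_n:=\mathbf 1+T_1+T_1T_2+\dots+T_1T_2\cdots T_{n-1}$, and where $\langle f^{(2)},\cdot\rangle_2$ and $l^{--}(f^{(2)}):H^{\otimes n}\to H^{\otimes(n-2)}$ are the bounded operators, linear and continuous in $f^{(2)}$, with $\langle f_1\otimes f_2,g\rangle_2=\langle f_2,g\rangle f_1$ and $l^{--}(f_1\otimes f_2)(g_1\otimes g_2\otimes\cdots\otimes g_n)=\langle f_2,g_1\rangle\langle f_1,g_2\rangle\,g_3\otimes\cdots\otimes g_n$. Let $\mathbb S$ be the continuous antilinear operator on $H^{\otimes2}$ with $\mathbb S(f\otimes g)=Jg\otimes Jf$, and let $\widehat T:=\mathbb ST\mathbb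 S$. **Theorem.** The operators $a^-(f)$, $f\in H$, are well defined: $a^-(f)$ is the unique linear operator on $\mathcal F_{\mathrm{fin}}(H)$ that is adjoint to $a^+(Jf)$. Moreover: 1. If $\widetilde T\in\mathcal L(H^{\otimes 2})$ satisfies $\langle Tf_1\otimes f_2,f_3\otimes f_4\rangle=\langle\widetilde Tf_3\otimes f_1,f_4\otimes f_2\rangle$ for all $f_1,f_2,f_3,f_4\in H$, then for all $f,g\in H$ $$a^-(f)a^+(g)=a^{+-}(\widetilde Tf\otimes g)+\langle f,g\rangle\mathbf 1.$$ 2. For every $f^{(2)}\in H^{\otimes 2}$: $a^{++}(f^{(2)})=\mathbf 0$ if and only if $f^{(2)}\in\ker(\mathbf 1+T)$, and $a^{--}(f^{(2)})=\mathbf 0$ if and only if $\mathbb Sf^{(2)}\in\ker(\mathbf 1+T)$. 3. If $f^{(2)}\in\ker(\mathbf 1-T^2)$, then $a^{++}(f^{(2)})=a^{++}(Tf^{(2)})$. If $\mathbb Sf^{(2)}\in\ker(\mathbf 1-T^2)$, then $a^{--}(f^{(2)})=a^{--}(\widehat Tf^{(2)})$. 4. These are all the creation–creation and annihilation–annihilation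 relations: for $h\in H^{\otimes 2}$, $a^{++}(h)=\mathbf 0$ if and only if $h=f-Tf$ for some $f\in\ker(\mathbf 1-T^2)$, and $a^{--}(h)=\mathbf 0$ if and only if $h=f-\widehat Tf$ for some $f\in H^{\otimes 2}$ with $\mathbb Sf\in\ker(\mathbf 1-T^2)$. -/

import Mathlib

open scoped TensorProduct ComplexConjugate

universe u

namespace TFock

/-! ### Hilbert tensor products -/

section HilbertTensor

variable {E F G E' F' : Type*}
  [NormedAddCommGroup E] [InnerProductSpace ℂ E] [NormedAddCommGroup F] [InnerProductSpace ℂ F]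
  [NormedAddCommGroup G] [InnerProductSpace ℂ G]
  [NormedAddCommGroup E'] [InnerProductSpace ℂ E'] [NormedAddCommGroup F'] [InnerProductSpace ℂ F']

/-- The Hilbert space tensor product: the completion of the algebraic tensor product with respect
to `⟪a ⊗ b, c ⊗ d⟫ = ⟪a, c⟫ * ⟪b, d⟫`. -/
abbrev HTensor (E F : Type*) [NormedAddCommGroup E] [InnerProductSpace ℂ E]
    [NormedAddCommGroup F] [InnerProductSpace ℂ F] : Type _ :=
  UniformSpace.Completion (E ⊗[ℂ] F)

/-- The simple tensor `x ⊗ y`, as a continuous bilinear map. -/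
noncomputable def tmul : E →L[ℂ] F →L[ℂ] HTensor E F :=
  (ContinuousLinearMap.compL ℂ F (E ⊗[ℂ] F) (HTensor E F) UniformSpace.Completion.toComplL) ∘L
    TensorProduct.mkL ℂ E F

theorem tmul_eq (x : E) (y : F) : tmul x y = ((x ⊗ₜ[ℂ] y : E ⊗[ℂ] F) : HTensor E F) := rfl

/-- The tensor product `A ⊗ B` of bounded linear operators. -/
noncomputable def mapT (A : E →L[ℂ] E') (B : F →L[ℂ] F') : HTensor E F →L[ℂ] HTensor E' F' :=
  (TensorProduct.mapL A B).completion

theorem mapT_tmul (A : E →L[ℂ] E') (B : F →L[ℂ] F') (x : E) (y : F) :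
    mapT A B (tmul x y) = tmul (A x) (B y) := by
  simp [mapT, tmul_eq]

theorem inner_tmul (x x' : E) (y y' : F) :
    inner ℂ (tmul x y) (tmul x' y') = inner ℂ x x' * inner ℂ y y' := by
  simp [tmul_eq]

theorem denseRange_rTensor {f : E →ₗᵢ[ℂ] E'} (hf : DenseRange f) :
    DenseRange (f.rTensor F) := by
  have hcl : ∀ z : E' ⊗[ℂ] F,
      z ∈ (LinearMap.range (f.rTensor F).toLinearMap).topologicalClosure := by
    intro z
    induction z with
    | zero => exact Submodule.zero_mem _
    | add a b ha hb => exact Submodule.add_mem _ ha hb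
    | tmul x y =>
      have hc : Continuous fun x : E' => x ⊗ₜ[ℂ] y :=
        ((TensorProduct.mkL ℂ E' F).flip y).continuous
      refine hf.induction_on (p := fun x => x ⊗ₜ[ℂ] y ∈
        (LinearMap.range (f.rTensor F).toLinearMap).topologicalClosure) x ?_ ?_
      · exact (Submodule.isClosed_topologicalClosure _).preimage hc
      · intro a
        exact Submodule.le_topologicalClosure _ ⟨a ⊗ₜ y, by simp⟩
  intro z
  exact hcl z

theorem denseRange_lTensor {f : F →ₗᵢ[ℂ] F'} (hf : DenseRange f) :
    DenseRange (f.lTensor E) := by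
  have hcl : ∀ z : E ⊗[ℂ] F',
      z ∈ (LinearMap.range (f.lTensor E).toLinearMap).topologicalClosure := by
    intro z
    induction z with
    | zero => exact Submodule.zero_mem _
    | add a b ha hb => exact Submodule.add_mem _ ha hb
    | tmul x y =>
      have hc : Continuous fun y : F' => x ⊗ₜ[ℂ] y := (TensorProduct.mkL ℂ E F' x).continuous
      refine hf.induction_on (p := fun y => x ⊗ₜ[ℂ] y ∈
        (LinearMap.range (f.lTensor E).toLinearMap).topologicalClosure) y ?_ ?_
      · exact (Submodule.isClosed_topologicalClosure _).preimage hc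
      · intro a
        exact Submodule.le_topologicalClosure _ ⟨x ⊗ₜ a, by simp⟩
  intro z
  exact hcl z

variable (E F G) in
/-- The inclusion of the algebraic triple tensor product in `(E ⊗ F) ⊗ G`. -/
noncomputable def inclLeft : (E ⊗[ℂ] F) ⊗[ℂ] G →ₗᵢ[ℂ] HTensor (HTensor E F) G :=
  UniformSpace.Completion.toComplₗᵢ.comp
    ((UniformSpace.Completion.toComplₗᵢ (𝕜 := ℂ) (E := E ⊗[ℂ] F)).rTensor G)

variable (E F G) in
/-- The inclusion of the algebraic triple tensor product in `E ⊗ (F ⊗ G)`. -/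
noncomputable def inclRight : E ⊗[ℂ] (F ⊗[ℂ] G) →ₗᵢ[ℂ] HTensor E (HTensor F G) :=
  UniformSpace.Completion.toComplₗᵢ.comp
    ((UniformSpace.Completion.toComplₗᵢ (𝕜 := ℂ) (E := F ⊗[ℂ] G)).lTensor E)

theorem denseRange_inclLeft : DenseRange (inclLeft E F G) :=
  UniformSpace.Completion.denseRange_coe.comp
    (denseRange_rTensor UniformSpace.Completion.denseRange_coe)
    (UniformSpace.Completion.continuous_coe _)

theorem denseRange_inclRight : DenseRange (inclRight E F G) :=
  UniformSpace.Completion.denseRange_coe.comp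
    (denseRange_lTensor UniformSpace.Completion.denseRange_coe)
    (UniformSpace.Completion.continuous_coe _)

variable (E F G) in
/-- The canonical identification of `(E ⊗ F) ⊗ G` with `E ⊗ (F ⊗ G)`. -/
noncomputable def assoc : HTensor (HTensor E F) G ≃ₗᵢ[ℂ] HTensor E (HTensor F G) :=
  (TensorProduct.assocIsometry ℂ E F G).toLinearEquiv.extendOfIsometry
    (inclLeft E F G).toLinearMap (inclRight E F G).toLinearMap
    denseRange_inclLeft denseRange_inclRight
    (fun x => by
      rw [LinearIsometry.coe_toLinearMap, LinearIsometry.coe_toLinearMap,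
        LinearIsometry.norm_map, LinearIsometry.norm_map]
      exact (TensorProduct.assocIsometry ℂ E F G).norm_map x)

theorem assoc_tmul (x : E) (y : F) (z : G) :
    assoc E F G (tmul (tmul x y) z) = tmul x (tmul y z) :=
  LinearEquiv.extendOfIsometry_eq (TensorProduct.assocIsometry ℂ E F G).toLinearEquiv
    (inclLeft E F G).toLinearMap (inclRight E F G).toLinearMap
    denseRange_inclLeft denseRange_inclRight _ ((x ⊗ₜ y) ⊗ₜ z)

end HilbertTensor

/-! ### The real structure -/

section RealStructure

variable {H : Type*} [NormedAddCommGroup H] [InnerProductSpace ℂ H]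

/-- The bilinear form `⟨f, g⟩ = (f, C g)` of a complex conjugation `C`
(Mathlib's inner product is linear in its second argument). -/
noncomputable def bil {K : Type*} [NormedAddCommGroup K] [InnerProductSpace ℂ K]
    (C : K → K) (f g : K) : ℂ := inner ℂ (C g) f

theorem norm_conj_map (J : H ≃ₗᵢ⋆[ℂ] H) (z : H ⊗[ℂ] H) :
    ‖TensorProduct.map J.toLinearEquiv.toLinearMap J.toLinearEquiv.toLinearMap z‖ = ‖z‖ := by
  have hJ : ∀ a b : H, inner ℂ (J a) (J b) = conj (inner ℂ a b) := by
    intro a b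
    have h1 : ∀ a b : H, (inner ℂ (J a) (J b)).re = (inner ℂ a b : ℂ).re := by
      intro a b
      have e1 := norm_add_sq (𝕜 := ℂ) a b
      have e2 := norm_add_sq (𝕜 := ℂ) (J a) (J b)
      rw [← map_add, J.norm_map, J.norm_map, J.norm_map] at e2
      have : RCLike.re (inner ℂ (J a) (J b)) = RCLike.re (inner ℂ a b : ℂ) := by linarith
      exact this
    apply Complex.ext
    · rw [h1, Complex.conj_re]
    · have := h1 (Complex.I • a) b
      rw [J.map_smulₛₗ, inner_smul_left, inner_smul_left] at this
      simp at this
      rw [Complex.conj_im]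
      linarith
  have key : ∀ z w : H ⊗[ℂ] H,
      inner ℂ (TensorProduct.map J.toLinearEquiv.toLinearMap J.toLinearEquiv.toLinearMap z)
        (TensorProduct.map J.toLinearEquiv.toLinearMap J.toLinearEquiv.toLinearMap w) =
      conj (inner ℂ z w) := by
    intro z w
    induction z with
    | zero => simp
    | add a b ha hb => simp only [map_add, inner_add_left, ha, hb]
    | tmul x y =>
      induction w with
      | zero => simp
      | add a b ha hb => simp only [map_add, inner_add_right, ha, hb]
      | tmul x' y' => simp [hJ]
  have hn : ∀ w : H ⊗[ℂ] H, inner ℂ w w = ((‖w‖ : ℝ) : ℂ) ^ 2 :=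
    fun w => inner_self_eq_norm_sq_to_K (𝕜 := ℂ) w
  have := key z z
  rw [hn, hn] at this
  simp only [map_pow, Complex.conj_ofReal] at this
  have h2 : ‖TensorProduct.map J.toLinearEquiv.toLinearMap J.toLinearEquiv.toLinearMap z‖ ^ 2
      = ‖z‖ ^ 2 := by exact_mod_cast this
  exact (pow_left_inj₀ (norm_nonneg _) (norm_nonneg _) two_ne_zero).mp h2

/-- The complex conjugation on `H ⊗ H`, i.e. `f ⊗ g ↦ J f ⊗ J g`. -/
noncomputable def conj2 (J : H ≃ₗᵢ⋆[ℂ] H) : HTensor H H →L⋆[ℂ] HTensor H H :=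
  ((TensorProduct.map J.toLinearEquiv.toLinearMap J.toLinearEquiv.toLinearMap).mkContinuous 1
    (fun z => by rw [norm_conj_map, one_mul])).completion

theorem conj2_tmul (J : H ≃ₗᵢ⋆[ℂ] H) (f g : H) : conj2 J (tmul f g) = tmul (J f) (J g) := by
  simp [conj2, tmul_eq]

/-- The antilinear operator `𝕊` on `H ⊗ H` with `𝕊 (f ⊗ g) = J (g ⊗ f)`. -/
noncomputable def opS (J : H ≃ₗᵢ⋆[ℂ] H) : HTensor H H →L⋆[ℂ] HTensor H H :=
  (conj2 J).comp
    (TensorProduct.commIsometry ℂ H H).toContinuousLinearEquiv.toContinuousLinearMap.completion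

theorem opS_tmul (J : H ≃ₗᵢ⋆[ℂ] H) (f g : H) : opS J (tmul f g) = tmul (J g) (J f) := by
  have h : (TensorProduct.commIsometry ℂ H H).toContinuousLinearEquiv.toContinuousLinearMap.completion
      (tmul f g) = tmul g f := by
    simp [tmul_eq]
  rw [opS, ContinuousLinearMap.comp_apply, h, conj2_tmul]

/-- The operator `T̂ = 𝕊 T 𝕊`. -/
noncomputable def opHat (J : H ≃ₗᵢ⋆[ℂ] H) (T : HTensor H H →L[ℂ] HTensor H H) :
    HTensor H H →L[ℂ] HTensor H H :=
  (opS J).comp (T.comp (opS J))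

/-- `T̃` is the operator on `H ⊗ H` with
`⟨T (f₁ ⊗ f₂), f₃ ⊗ f₄⟩ = ⟨T̃ (f₃ ⊗ f₁), f₄ ⊗ f₂⟩`. -/
def IsTilde (J : H ≃ₗᵢ⋆[ℂ] H) (T Tt : HTensor H H →L[ℂ] HTensor H H) : Prop :=
  ∀ f₁ f₂ f₃ f₄ : H,
    bil (conj2 J) (T (tmul f₁ f₂)) (tmul f₃ f₄) = bil (conj2 J) (Tt (tmul f₃ f₁)) (tmul f₄ f₂)

/-- The Yang--Baxter equation `(T ⊗ 1)(1 ⊗ T)(T ⊗ 1) = (1 ⊗ T)(T ⊗ 1)(1 ⊗ T)` on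
`H ⊗ (H ⊗ H)`. -/
def YangBaxter (T : HTensor H H →L[ℂ] HTensor H H) : Prop :=
  let A : HTensor H (HTensor H H) →L[ℂ] HTensor H (HTensor H H) :=
    (assoc H H H).toContinuousLinearEquiv.toContinuousLinearMap ∘L
      mapT T (ContinuousLinearMap.id ℂ H) ∘L
      (assoc H H H).symm.toContinuousLinearEquiv.toContinuousLinearMap
  let B : HTensor H (HTensor H H) →L[ℂ] HTensor H (HTensor H H) :=
    mapT (ContinuousLinearMap.id ℂ H) T
  A ∘L B ∘L A = B ∘L A ∘L B

end RealStructure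

/-! ### Reduced words in the symmetric group -/

/-- The adjacent transposition of `i` and `i + 1` (counting from `0`) in the permutations of
`Fin n`; the identity if `i + 1` is out of range. -/
def adjSwap (n i : ℕ) : Equiv.Perm (Fin n) :=
  if h : i + 1 < n then Equiv.swap ⟨i, by omega⟩ ⟨i + 1, h⟩ else 1

/-- The product of the adjacent transpositions listed in a word. -/
def wordPerm (n : ℕ) (w : List ℕ) : Equiv.Perm (Fin n) := (w.map (adjSwap n)).prod

/-- A word is a reduced expression of `σ` if it represents `σ` and no shorter word does. -/
def IsReducedWord {n : ℕ} (σ : Equiv.Perm (Fin n)) (w : List ℕ) : Prop :=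
  wordPerm n w = σ ∧ ∀ v : List ℕ, wordPerm n v = σ → w.length ≤ v.length

/-- A reduced expression of `σ` (see `isReducedWord_redWord`): with `k = σ⁻¹ 0`, it is a reduced
expression of `σ (0 1 ⋯ k)⁻¹`, which fixes `0`, followed by `0, 1, …, k - 1`. -/
def redWord : (n : ℕ) → Equiv.Perm (Fin n) → List ℕ
  | 0, _ => []
  | n + 1, σ =>
    (redWord n (Equiv.Perm.decomposeFin (σ * (Fin.cycleRange (σ⁻¹ 0))⁻¹)).2).map Nat.succ ++
      List.range (σ⁻¹ 0 : Fin (n + 1))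

/-- The set of inversions of a permutation. -/
def invs {n : ℕ} (σ : Equiv.Perm (Fin n)) : Finset (Fin n × Fin n) :=
  Finset.univ.filter fun p => p.1 < p.2 ∧ σ p.2 < σ p.1

theorem mem_invs {n : ℕ} (σ : Equiv.Perm (Fin n)) (a b : Fin n) :
    (a, b) ∈ invs σ ↔ a < b ∧ σ b < σ a := by
  simp [invs]

theorem card_invs_adjSwap_mul {n : ℕ} (i : ℕ) (σ : Equiv.Perm (Fin n)) :
    (invs (adjSwap n i * σ)).card ≤ (invs σ).card + 1 := by
  unfold adjSwap
  split_ifs with h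
  · refine le_trans (Finset.card_le_card (t := insert
      (σ⁻¹ ⟨i, by omega⟩, σ⁻¹ ⟨i + 1, h⟩) (invs σ)) ?_) (Finset.card_insert_le _ _)
    rintro ⟨a, b⟩ hab
    rw [mem_invs, Equiv.Perm.mul_apply, Equiv.Perm.mul_apply] at hab
    rw [Finset.mem_insert, mem_invs, Prod.mk.injEq, Equiv.Perm.eq_inv_iff_eq,
      Equiv.Perm.eq_inv_iff_eq]
    obtain ⟨h1, h2⟩ := hab
    by_cases h3 : σ b < σ a
    · exact Or.inr ⟨h1, h3⟩
    · left
      have h4 : σ a ≠ σ b := fun hh => h1.ne (σ.injective hh)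
      generalize σ a = x at *
      generalize σ b = y at *
      simp only [Equiv.swap_apply_def, Fin.ext_iff, Fin.lt_def] at *
      split_ifs at h2 <;> simp_all <;> omega
  · simp

theorem card_invs_wordPerm_le (n : ℕ) (w : List ℕ) :
    (invs (wordPerm n w)).card ≤ w.length := by
  induction w with
  | nil =>
    have : invs (wordPerm n []) = ∅ := by
      simp only [invs, wordPerm, List.map_nil, List.prod_nil, Equiv.Perm.one_apply]
      ext ⟨a, b⟩
      simp only [Finset.mem_filter, Finset.mem_univ, true_and, Finset.notMem_empty, iff_false]
      exact fun hh => lt_asymm hh.1 hh.2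
    simp [this]
  | cons i w ih =>
    have h := card_invs_adjSwap_mul i (wordPerm n w)
    have : wordPerm n (i :: w) = adjSwap n i * wordPerm n w := by simp [wordPerm]
    rw [this, List.length_cons]
    omega

theorem wordPerm_range {n : ℕ} (k : Fin (n + 1)) :
    wordPerm (n + 1) (List.range k) = Fin.cycleRange k := by
  obtain ⟨k, hk⟩ := k
  induction k with
  | zero => simp [wordPerm]
  | succ k ih =>
    have h := ih (by omega)
    simp only at h ⊢
    rw [List.range_succ, wordPerm, List.map_append, List.prod_append, ← wordPerm, h]
    ext j
    simp only [List.map_cons, List.map_nil, List.prod_cons, List.prod_nil, mul_one,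
      Equiv.Perm.mul_apply, adjSwap, hk, dif_pos]
    simp only [Equiv.swap_apply_def]
    split_ifs with h1 h2
    · subst h1
      rw [Fin.cycleRange_of_gt (by simp [Fin.lt_def]), Fin.cycleRange_of_lt (by simp [Fin.lt_def])]
      rw [Fin.val_add_one_of_lt' (by simpa using hk)]
    · subst h2
      rw [Fin.cycleRange_of_eq rfl, Fin.cycleRange_of_eq rfl]
    · rcases lt_trichotomy (j : ℕ) k with h3 | h3 | h3
      · rw [Fin.cycleRange_of_lt (by simpa [Fin.lt_def] using h3),
          Fin.cycleRange_of_lt (by simp only [Fin.lt_def]; omega)]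
      · exact absurd (Fin.ext h3) h1
      · have h4 : (j : ℕ) ≠ k + 1 := fun hh => h2 (Fin.ext hh)
        rw [Fin.cycleRange_of_gt (by simpa [Fin.lt_def] using h3),
          Fin.cycleRange_of_gt (by simp only [Fin.lt_def]; omega)]

/-- `redPart σ` is the permutation of `Fin n` that `σ (0 1 ⋯ k)⁻¹`, `k = σ⁻¹ 0`, induces. -/
def redPart {n : ℕ} (σ : Equiv.Perm (Fin (n + 1))) : Equiv.Perm (Fin n) :=
  (Equiv.Perm.decomposeFin (σ * (Fin.cycleRange (σ⁻¹ 0))⁻¹)).2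

theorem decomposeFin_redPart {n : ℕ} (σ : Equiv.Perm (Fin (n + 1))) :
    Equiv.Perm.decomposeFin.symm (0, redPart σ) = σ * (Fin.cycleRange (σ⁻¹ 0))⁻¹ := by
  have h0 : (Equiv.Perm.decomposeFin (σ * (Fin.cycleRange (σ⁻¹ 0))⁻¹)).1 = 0 := by
    have h1 := Equiv.Perm.decomposeFin_symm_apply_zero
      (Equiv.Perm.decomposeFin (σ * (Fin.cycleRange (σ⁻¹ 0))⁻¹)).1
      (Equiv.Perm.decomposeFin (σ * (Fin.cycleRange (σ⁻¹ 0))⁻¹)).2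
    rw [Prod.mk.eta, Equiv.symm_apply_apply] at h1
    rw [← h1, Equiv.Perm.mul_apply, Equiv.Perm.inv_def, Fin.cycleRange_symm_zero]
    simp
  rw [Equiv.symm_apply_eq]
  exact Prod.ext h0.symm rfl

theorem redPart_succ {n : ℕ} (σ : Equiv.Perm (Fin (n + 1))) (a : Fin n) :
    (redPart σ a).succ = σ ((σ⁻¹ 0).succAbove a) := by
  have h := congrArg (fun τ : Equiv.Perm (Fin (n + 1)) => τ a.succ) (decomposeFin_redPart σ)
  simp only [Equiv.Perm.decomposeFin_symm_apply_succ, Equiv.Perm.mul_apply, Equiv.Perm.inv_def,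
    Fin.cycleRange_symm_succ] at h
  simpa using h

theorem wordPerm_map_succ (n : ℕ) (w : List ℕ) :
    wordPerm (n + 1) (w.map Nat.succ) = Equiv.Perm.decomposeFin.symm (0, wordPerm n w) := by
  have hs : ∀ (τ : Equiv.Perm (Fin n)) (x : Fin n),
      Equiv.Perm.decomposeFin.symm (0, τ) x.succ = (τ x).succ := by
    intro τ x; simp
  have hz : ∀ τ : Equiv.Perm (Fin n), Equiv.Perm.decomposeFin.symm (0, τ) 0 = 0 := by
    intro τ; simp
  induction w with
  | nil =>
    refine Equiv.ext fun x => ?_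
    refine Fin.cases ?_ (fun y => ?_) x
    · rw [hz]; simp [wordPerm]
    · rw [hs]; simp [wordPerm]
  | cons i w ih =>
    have e1 : wordPerm (n + 1) ((i :: w).map Nat.succ) =
        adjSwap (n + 1) (i + 1) * wordPerm (n + 1) (w.map Nat.succ) := by simp [wordPerm]
    have e2 : wordPerm n (i :: w) = adjSwap n i * wordPerm n w := by simp [wordPerm]
    have e3 : adjSwap (n + 1) (i + 1) = Equiv.Perm.decomposeFin.symm (0, adjSwap n i) := by
      refine Equiv.ext fun x => ?_
      refine Fin.cases ?_ (fun y => ?_) x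
      · rw [hz]
        unfold adjSwap
        split_ifs with h
        · simp [Equiv.swap_apply_def, Fin.ext_iff]
        · simp
      · rw [hs]
        unfold adjSwap
        by_cases h : i + 1 < n
        · rw [dif_pos h, dif_pos (by omega)]
          simp only [Equiv.swap_apply_def, Fin.ext_iff, Fin.val_succ, Nat.add_right_cancel_iff]
          split_ifs <;> simp
        · rw [dif_neg h, dif_neg (by omega)]
          simp
    rw [e1, e2, e3, ih]
    refine Equiv.ext fun x => ?_
    refine Fin.cases ?_ (fun y => ?_) x
    · rw [Equiv.Perm.mul_apply, hz, hz, hz]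
    · rw [Equiv.Perm.mul_apply, hs, hs, hs, Equiv.Perm.mul_apply]

theorem wordPerm_redWord (n : ℕ) (σ : Equiv.Perm (Fin n)) : wordPerm n (redWord n σ) = σ := by
  induction n with
  | zero => exact Subsingleton.elim _ _
  | succ n ih =>
    have e : wordPerm (n + 1) (redWord (n + 1) σ) =
        wordPerm (n + 1) ((redWord n (redPart σ)).map Nat.succ) *
          wordPerm (n + 1) (List.range (σ⁻¹ 0 : Fin (n + 1))) := by
      simp only [wordPerm, redWord, List.map_append, List.prod_append, redPart]
    rw [e, wordPerm_map_succ, ih, wordPerm_range, decomposeFin_redPart, inv_mul_cancel_right]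

theorem length_redWord_le (n : ℕ) (σ : Equiv.Perm (Fin n)) :
    (redWord n σ).length ≤ (invs σ).card := by
  induction n with
  | zero => simp [redWord]
  | succ n ih =>
    have e : (redWord (n + 1) σ).length =
        (redWord n (redPart σ)).length + (σ⁻¹ 0 : Fin (n + 1)) := by
      simp [redWord, redPart]
    have hk : σ (σ⁻¹ 0) = 0 := by simp
    set k := σ⁻¹ 0 with hkdef
    have hA : ((invs (redPart σ)).image fun p => (k.succAbove p.1, k.succAbove p.2)).card =
        (invs (redPart σ)).card := by
      refine Finset.card_image_of_injective _ ?_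
      rintro ⟨a, b⟩ ⟨c, d⟩ h
      simpa using h
    have hB : ((Finset.Iio k).image fun j => (j, k)).card = (k : ℕ) := by
      rw [Finset.card_image_of_injective _ (fun a b h => by simpa using h), Fin.card_Iio]
    have hd : Disjoint ((invs (redPart σ)).image fun p => (k.succAbove p.1, k.succAbove p.2))
        ((Finset.Iio k).image fun j => (j, k)) := by
      rw [Finset.disjoint_left]
      intro x hx hy
      simp only [Finset.mem_image] at hx hy
      obtain ⟨p, -, rfl⟩ := hx
      obtain ⟨j, -, hj⟩ := hy
      exact Fin.succAbove_ne k p.2 (congrArg Prod.snd hj).symm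
    have hsub : ((invs (redPart σ)).image fun p => (k.succAbove p.1, k.succAbove p.2)) ∪
        ((Finset.Iio k).image fun j => (j, k)) ⊆ invs σ := by
      intro x hx
      rw [Finset.mem_union] at hx
      rcases hx with hx | hx
      · simp only [Finset.mem_image] at hx
        obtain ⟨⟨a, b⟩, hp, rfl⟩ := hx
        simp only [invs, Finset.mem_filter, Finset.mem_univ, true_and] at hp ⊢
        refine ⟨Fin.strictMono_succAbove k hp.1, ?_⟩
        have h1 := redPart_succ σ a
        have h2 := redPart_succ σ b
        rw [← hkdef] at h1 h2
        rw [← h1, ← h2]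
        exact Fin.succ_lt_succ_iff.mpr hp.2
      · simp only [Finset.mem_image, Finset.mem_Iio] at hx
        obtain ⟨j, hj, rfl⟩ := hx
        simp only [invs, Finset.mem_filter, Finset.mem_univ, true_and]
        refine ⟨hj, ?_⟩
        rw [hk]
        refine Fin.pos_iff_ne_zero.mpr fun h0 => hj.ne ?_
        rw [← hk] at h0
        exact σ.injective h0
    have := Finset.card_le_card hsub
    rw [Finset.card_union_of_disjoint hd, hA, hB] at this
    have := ih (redPart σ)
    omega

theorem isReducedWord_redWord (n : ℕ) (σ : Equiv.Perm (Fin n)) :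
    IsReducedWord σ (redWord n σ) := by
  refine ⟨wordPerm_redWord n σ, fun v hv => ?_⟩
  have h1 := length_redWord_le n σ
  have h2 := card_invs_wordPerm_le n v
  rw [hv] at h2
  omega

/-! ### Tensor powers and the operators `𝒫ₙ` -/

/-- A complex Hilbert space, bundled. -/
structure HilbertSpace where
  carrier : Type u
  [normed : NormedAddCommGroup carrier]
  [innerProduct : InnerProductSpace ℂ carrier]
  [complete : CompleteSpace carrier]

section Powers

variable (H : Type u) [NormedAddCommGroup H] [InnerProductSpace ℂ H]

/-- The tensor powers: `H^{⊗0}` is the one-dimensional space `ℂ` (in the universe of `H`), and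
`H^{⊗(n+1)} = H ⊗ H^{⊗n}`. -/
noncomputable def tower : ℕ → HilbertSpace.{u}
  | 0 => ⟨EuclideanSpace ℂ PUnit.{u + 1}⟩
  | n + 1 =>
    letI := (tower n).normed
    letI := (tower n).innerProduct
    ⟨HTensor H (tower n).carrier⟩

/-- The `n`-th Hilbert tensor power `H^{⊗n}`. -/
def HPow (n : ℕ) : Type u := (tower H n).carrier

noncomputable instance (n : ℕ) : NormedAddCommGroup (HPow H n) := (tower H n).normed

noncomputable instance (n : ℕ) : InnerProductSpace ℂ (HPow H n) := (tower H n).innerProduct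

instance (n : ℕ) : CompleteSpace (HPow H n) := (tower H n).complete

/-- The identification `H ⊗ H^{⊗n} = H^{⊗(n+1)}`. -/
noncomputable def cons (n : ℕ) : HTensor H (HPow H n) ≃ₗᵢ[ℂ] HPow H (n + 1) :=
  LinearIsometryEquiv.refl ℂ (HTensor H (HPow H n))

/-- The identification `(H ⊗ H) ⊗ H^{⊗n} = H^{⊗(n+2)}`. -/
noncomputable def cons2 (n : ℕ) : HTensor (HTensor H H) (HPow H n) ≃ₗᵢ[ℂ] HPow H (n + 2) :=
  (assoc H H (HPow H n)).trans (cons H (n + 1))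

variable {H}

theorem cons2_tmul (f g : H) (n : ℕ) (x : HPow H n) :
    cons2 H n (tmul (tmul f g) x) = cons H (n + 1) (tmul f (cons H n (tmul g x))) := by
  have h := assoc_tmul f g x
  show (assoc H H (HPow H n)) ((tmul (tmul f g)) x) = _
  exact h

/-- The operator `A ⊗ 1` on `H^{⊗(n+1)} = H ⊗ H^{⊗n}`. -/
noncomputable def onFirst (n : ℕ) (A : H →L[ℂ] H) : HPow H (n + 1) →L[ℂ] HPow H (n + 1) :=
  (cons H n).toContinuousLinearEquiv.toContinuousLinearMap ∘L
    mapT A (ContinuousLinearMap.id ℂ (HPow H n)) ∘L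
    (cons H n).symm.toContinuousLinearEquiv.toContinuousLinearMap

/-- The operator `A ⊗ 1` on `H^{⊗(n+2)} = (H ⊗ H) ⊗ H^{⊗n}`. -/
noncomputable def onHead (n : ℕ) (A : HTensor H H →L[ℂ] HTensor H H) :
    HPow H (n + 2) →L[ℂ] HPow H (n + 2) :=
  (cons2 H n).toContinuousLinearEquiv.toContinuousLinearMap ∘L
    mapT A (ContinuousLinearMap.id ℂ (HPow H n)) ∘L
    (cons2 H n).symm.toContinuousLinearEquiv.toContinuousLinearMap

/-- The operator `1 ⊗ A` on `H^{⊗(n+1)} = H ⊗ H^{⊗n}`. -/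
noncomputable def onTail {n : ℕ} (A : HPow H n →L[ℂ] HPow H n) :
    HPow H (n + 1) →L[ℂ] HPow H (n + 1) :=
  (cons H n).toContinuousLinearEquiv.toContinuousLinearMap ∘L
    mapT (ContinuousLinearMap.id ℂ H) A ∘L
    (cons H n).symm.toContinuousLinearEquiv.toContinuousLinearMap

/-- The operator on `H^{⊗n}` that is `T` on the tensor factors `i` and `i + 1`, counted from `0`,
and the identity on the others (for `i + 1 < n`; the identity otherwise). -/
noncomputable def leg (T : HTensor H H →L[ℂ] HTensor H H) :
    (n : ℕ) → ℕ → (HPow H n →L[ℂ] HPow H n)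
  | 0, _ => 1
  | 1, _ => 1
  | n + 2, 0 => onHead n T
  | n + 2, i + 1 => onTail (leg T (n + 1) i)

/-- The operator `T_σ` on `H^{⊗n}`: the product of the `leg T n i` along a reduced expression
of `σ`. -/
noncomputable def permOp (T : HTensor H H →L[ℂ] HTensor H H) {n : ℕ} (σ : Equiv.Perm (Fin n)) :
    HPow H n →L[ℂ] HPow H n :=
  ((redWord n σ).map (leg T n)).prod

/-- The operator `𝒫ₙ = ∑ T_σ` on `H^{⊗n}`. -/
noncomputable def opP (T : HTensor H H →L[ℂ] HTensor H H) (n : ℕ) : HPow H n →L[ℂ] HPow H n :=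
  ∑ σ : Equiv.Perm (Fin n), permOp T σ

/-- The operator `𝕋ₙ = 1 + T₁ + T₁T₂ + ⋯ + T₁T₂⋯Tₙ₋₁` on `H^{⊗n}`, `n ≥ 1`. -/
noncomputable def opR (T : HTensor H H →L[ℂ] HTensor H H) (n : ℕ) : HPow H n →L[ℂ] HPow H n :=
  ∑ k ∈ Finset.range n, ((List.range k).map (leg T n)).prod

/-- The `n`-particle space `ℱₙ(H)`, the orthogonal complement of the kernel of `𝒫ₙ`. -/
noncomputable def nParticle (T : HTensor H H →L[ℂ] HTensor H H) (n : ℕ) :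
    Submodule ℂ (HPow H n) :=
  (opP T n).kerᗮ

instance (T : HTensor H H →L[ℂ] HTensor H H) (n : ℕ) : CompleteSpace (nParticle T n) :=
  inferInstanceAs (CompleteSpace (opP T n).kerᗮ)

/-- The orthogonal projection `ℙₙ` of `H^{⊗n}` onto `ℱₙ(H)`. -/
noncomputable def proj (T : HTensor H H →L[ℂ] HTensor H H) (n : ℕ) :
    HPow H n →L[ℂ] nParticle T n :=
  (nParticle T n).orthogonalProjectionOnto

end Powers

/-! ### Operators on the full Fock space -/

section FullFock

variable {H : Type u} [NormedAddCommGroup H] [InnerProductSpace ℂ H]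

/-- The left creation operator `l⁺(f) g = f ⊗ g`. -/
noncomputable def lPlus (f : H) (n : ℕ) : HPow H n →L[ℂ] HPow H (n + 1) :=
  (cons H n).toContinuousLinearEquiv.toContinuousLinearMap ∘L tmul f

/-- The operator `l⁺⁺(f) g = f ⊗ g` for `f ∈ H ⊗ H`. -/
noncomputable def lPP (f : HTensor H H) (n : ℕ) : HPow H n →L[ℂ] HPow H (n + 2) :=
  (cons2 H n).toContinuousLinearEquiv.toContinuousLinearMap ∘L tmul f

/-- The operator `l⁻⁻(f) = l⁺⁺(𝕊 f)*`; it is linear and continuous in `f`, and equals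
`l⁻(f₁) l⁻(f₂)` if `f = f₁ ⊗ f₂`, where `l⁻(h) = l⁺(J h)*` (see `lMM_tmul`). -/
noncomputable def lMM (J : H ≃ₗᵢ⋆[ℂ] H) (f : HTensor H H) (n : ℕ) :
    HPow H (n + 2) →L[ℂ] HPow H n :=
  (lPP (opS J f) n).adjoint

theorem lPP_tmul (f g : H) (n : ℕ) (x : HPow H n) :
    lPP (tmul f g) n x = lPlus f (n + 1) (lPlus g n x) := by
  simp [lPP, lPlus, cons2_tmul]

theorem lMM_tmul (J : H ≃ₗᵢ⋆[ℂ] H) (f g : H) (n : ℕ) (x : HPow H (n + 2)) :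
    lMM J (tmul f g) n x = (lPlus (J f) n).adjoint ((lPlus (J g) (n + 1)).adjoint x) := by
  refine ext_inner_left ℂ fun y => ?_
  simp [lMM, ContinuousLinearMap.adjoint_inner_right, opS_tmul, lPP_tmul]

variable [CompleteSpace H]

/-- The Hilbert--Schmidt operator `⟨f, ·⟩₂` of `f ∈ H ⊗ H`, with
`⟨f₁ ⊗ f₂, g⟩₂ = ⟨f₂, g⟩ f₁`. It sends `g` to the image of `f` under the adjoint of
`x ↦ x ⊗ J g`. -/
noncomputable def slice (J : H ≃ₗᵢ⋆[ℂ] H) (f : HTensor H H) : H →L[ℂ] H :=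
  (ContinuousLinearMap.apply ℂ H f).comp
    ((ContinuousLinearMap.adjoint (𝕜 := ℂ) (E := H)
        (F := HTensor H H)).toContinuousLinearEquiv.toContinuousLinearMap.comp
      ((tmul (E := H) (F := H)).flip.comp J.toContinuousLinearEquiv.toContinuousLinearMap))

theorem slice_tmul (J : H ≃ₗᵢ⋆[ℂ] H) (f₁ f₂ g : H) :
    slice J (tmul f₁ f₂) g = bil J f₂ g • f₁ := by
  refine ext_inner_left ℂ fun x => ?_
  have : slice J (tmul f₁ f₂) g =
      ContinuousLinearMap.adjoint ((tmul (E := H) (F := H)).flip (J g)) (tmul f₁ f₂) := rfl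
  rw [this, ContinuousLinearMap.adjoint_inner_right, ContinuousLinearMap.flip_apply, inner_tmul,
    inner_smul_right, bil, mul_comm]

/-- The operator `l⁺⁻(f) = ⟨f, ·⟩₂ ⊗ 1` on `H^{⊗(n+1)}`. -/
noncomputable def lPM (J : H ≃ₗᵢ⋆[ℂ] H) (f : HTensor H H) (n : ℕ) :
    HPow H (n + 1) →L[ℂ] HPow H (n + 1) :=
  onFirst n (slice J f)

end FullFock

/-! ### The `T`-deformed Fock space and its operators -/

section Fock

variable {H : Type u} [NormedAddCommGroup H] [InnerProductSpace ℂ H]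

/-- The space `ℱ_fin(H)` of finite sequences `(f⁽⁰⁾, f⁽¹⁾, …)` with `f⁽ⁿ⁾ ∈ ℱₙ(H)`. -/
abbrev FockFin (T : HTensor H H →L[ℂ] HTensor H H) : Type u :=
  DirectSum ℕ fun n => nParticle T n

open Classical in
/-- The inner product of the `T`-deformed Fock space, `∑ₙ (f⁽ⁿ⁾, 𝒫ₙ g⁽ⁿ⁾)`, on `ℱ_fin(H)`
(antilinear in the first argument). -/
noncomputable def fockInner (T : HTensor H H →L[ℂ] HTensor H H) (x y : FockFin T) : ℂ :=
  DFinsupp.sum y fun n yn => inner ℂ (x n : HPow H n) (opP T n (yn : HPow H n))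

/-- `B` is the restriction to `ℱ_fin(H)` of the adjoint of `A` with respect to the inner product of
the `T`-deformed Fock space. -/
def IsFockAdjoint (T : HTensor H H →L[ℂ] HTensor H H) (A B : FockFin T →ₗ[ℂ] FockFin T) : Prop :=
  ∀ x y : FockFin T, fockInner T (A x) y = fockInner T x (B y)

/-- The linear operator on `ℱ_fin(H)` that acts on `ℱₙ(H)` as `A n : ℱₙ(H) → ℱ_{d n}(H)`. -/
noncomputable def gradedOp (T : HTensor H H →L[ℂ] HTensor H H) (d : ℕ → ℕ)
    (A : (n : ℕ) → nParticle T n →ₗ[ℂ] nParticle T (d n)) : FockFin T →ₗ[ℂ] FockFin T :=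
  DirectSum.toModule ℂ ℕ (FockFin T) fun n =>
    DirectSum.lof ℂ ℕ (fun n => nParticle T n) (d n) ∘ₗ A n

/-- The creation operator `a⁺(f) g⁽ⁿ⁾ = ℙₙ₊₁ (f ⊗ g⁽ⁿ⁾)`. -/
noncomputable def aPlus (T : HTensor H H →L[ℂ] HTensor H H) (f : H) :
    FockFin T →ₗ[ℂ] FockFin T :=
  gradedOp T (fun n => n + 1) fun n =>
    (proj T (n + 1) ∘L lPlus f n ∘L (nParticle T n).subtypeL).toLinearMap

open Classical in
/-- The annihilation operator: `a⁻(f)` is the restriction of `a⁺(J f)*` to `ℱ_fin(H)`. -/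
noncomputable def aMinus (J : H ≃ₗᵢ⋆[ℂ] H) (T : HTensor H H →L[ℂ] HTensor H H) (f : H) :
    FockFin T →ₗ[ℂ] FockFin T :=
  if h : ∃ B, IsFockAdjoint T (aPlus T (J f)) B then h.choose else 0

/-- The operator `a⁺⁺(f) g⁽ⁿ⁾ = ℙₙ₊₂ (l⁺⁺(f) g⁽ⁿ⁾)` for `f ∈ H ⊗ H`. -/
noncomputable def aPP (T : HTensor H H →L[ℂ] HTensor H H) (f : HTensor H H) :
    FockFin T →ₗ[ℂ] FockFin T :=
  gradedOp T (fun n => n + 2) fun n =>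
    (proj T (n + 2) ∘L lPP f n ∘L (nParticle T n).subtypeL).toLinearMap

/-- The operator `a⁻⁻(f)`, `f ∈ H ⊗ H`: it vanishes on `ℱ₀(H)` and `ℱ₁(H)`, and
`a⁻⁻(f) g⁽ⁿ⁾ = ℙₙ₋₂ l⁻⁻(f) (1 ⊗ (𝕋ₙ₋₁ ℙₙ₋₁)) 𝕋ₙ g⁽ⁿ⁾` for `n ≥ 2`. -/
noncomputable def aMM (J : H ≃ₗᵢ⋆[ℂ] H) (T : HTensor H H →L[ℂ] HTensor H H) (f : HTensor H H) :
    FockFin T →ₗ[ℂ] FockFin T :=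
  gradedOp T (fun n => n - 2) fun
    | 0 => 0
    | 1 => 0
    | n + 2 =>
      (proj T n ∘L lMM J f n ∘L
        onTail (opR T (n + 1) ∘L (nParticle T (n + 1)).subtypeL ∘L proj T (n + 1)) ∘L
        opR T (n + 2) ∘L (nParticle T (n + 2)).subtypeL).toLinearMap

variable [CompleteSpace H]

/-- The operator `a⁺⁻(f)`, `f ∈ H ⊗ H`: it vanishes on `ℱ₀(H)`, and
`a⁺⁻(f) g⁽ⁿ⁾ = ℙₙ l⁺⁻(f) 𝕋ₙ g⁽ⁿ⁾` for `n ≥ 1`. -/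
noncomputable def aPM (J : H ≃ₗᵢ⋆[ℂ] H) (T : HTensor H H →L[ℂ] HTensor H H) (f : HTensor H H) :
    FockFin T →ₗ[ℂ] FockFin T :=
  gradedOp T (fun n => n) fun
    | 0 => 0
    | n + 1 =>
      (proj T (n + 1) ∘L lPM J f n ∘L opR T (n + 1) ∘L
        (nParticle T (n + 1)).subtypeL).toLinearMap

end Fock

end TFock

namespace TFock

/-! Everything rests on two recursions. Splitting a permutation along the cosets of the subgroup
fixing `0` gives `𝒫ₙ₊₁ = (1 ⊗ 𝒫ₙ) 𝕋ₙ₊₁` (`opP_succ`), and `𝕋ₙ₊₂ = 1 + T₁ (1 ⊗ 𝕋ₙ₊₁)`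
(`opR_succ_succ`). From them `𝒫ₙ` is self-adjoint by induction. Since `𝒫ₙ` is injective on `(ker
𝒫ₙ)ᗮ`, the form of `ℱ_fin(H)` is non-degenerate, so adjoints are unique and an operator vanishes
exactly when its adjoint does.

The first recursion shows that the adjoint of `a⁺(f)` is `ℙₙ l⁺(f)* 𝕋ₙ₊₁` on `ℱₙ₊₁(H)`. Inserting
the second recursion into `a⁻(f) a⁺(g)` yields the scalar `⟨f, g⟩` from the summand `1`, and
`l⁺(Jf)* T₁ l⁺(g) = l⁺⁻(T̃ (f ⊗ g))` from the rest (`adjoint_lPlus_onHead`).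

For the quadratic relations, the Yang–Baxter equation makes `1 + T₁` a left factor of `(1 ⊗ 𝕋ₙ₊₁)
𝕋ₙ₊₂`, hence of `𝒫ₙ₊₂`; by self-adjointness it is also a right factor (`exists_opP_eq_mul`). So
`𝒫ₙ₊₂ (f ⊗ g) = 0` whenever `f ∈ ker (1 + T)`. Conversely, the vacuum already detects `f`, because
`𝒫₂ = 1 + T`. The annihilation side follows because `a⁻⁻(f)` is adjoint to `a⁺⁺(𝕊 f)`. The remaining
claims are algebra: `T f - f` measures the failure of a relation, and `ker (1 + T)` is the image of
`ker (1 - T²)` under `1 - T`. -/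

/-- Both `p t r` and its adjoint `r* t p` equal `r* b t r`. This is the induction step for `𝒫ₙ₊₂`,
with `p = 1 ⊗ 𝒫ₙ₊₁`, `b = 1 ⊗ 1 ⊗ 𝒫ₙ`, `r = 1 ⊗ 𝕋ₙ₊₁` and `t = T₁`. -/
theorem isSelfAdjoint_mul_one_add {A : Type*} [Ring A] [StarRing A] {b p r t : A}
    (hp : IsSelfAdjoint p) (h : p = b * r) (h' : p = star r * b) (ht : IsSelfAdjoint t)
    (htb : t * b = b * t) :
    IsSelfAdjoint (p * (1 + t * r)) := by
  rw [isSelfAdjoint_iff]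
  calc star (p * (1 + t * r)) = p + star r * (t * p) := by
        rw [star_mul, star_add, star_one, star_mul, ht.star_eq, hp.star_eq, add_mul, one_mul,
          mul_assoc]
    _ = p + star r * b * t * r := by
        nth_rewrite 2 [h]
        rw [← mul_assoc t, htb]
        simp only [mul_assoc]
    _ = _ := by rw [← h', mul_add, mul_one, mul_assoc]

/-! ### Bounded operators on Hilbert tensor products -/

section HilbertTensor

variable {E F G E' F' : Type*}
  [NormedAddCommGroup E] [InnerProductSpace ℂ E] [NormedAddCommGroup F] [InnerProductSpace ℂ F]
  [NormedAddCommGroup G] [InnerProductSpace ℂ G]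
  [NormedAddCommGroup E'] [InnerProductSpace ℂ E'] [NormedAddCommGroup F'] [InnerProductSpace ℂ F']

/-- Simple tensors span a dense subspace. Most operator identities below are reduced to simple
tensors in this way. -/
theorem semilinear_ext_tmul {σ : ℂ →+* ℂ} {A B : HTensor E F →SL[σ] G}
    (h : ∀ x y, A (tmul x y) = B (tmul x y)) : A = B := by
  ext z
  induction z using UniformSpace.Completion.induction_on with
  | hp => exact isClosed_eq A.continuous B.continuous
  | ih z =>
    induction z with
    | zero => exact (map_zero A).trans (map_zero B).symm
    | add a b ha hb => rw [UniformSpace.Completion.coe_add, map_add, map_add, ha, hb]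
    | tmul x y => exact h x y

theorem mapT_adjoint [CompleteSpace E] [CompleteSpace F] [CompleteSpace E'] [CompleteSpace F']
    (A : E →L[ℂ] E') (B : F →L[ℂ] F') :
    (mapT A B).adjoint = mapT A.adjoint B.adjoint := by
  refine semilinear_ext_tmul fun x y => ext_inner_right ℂ fun z => ?_
  rw [ContinuousLinearMap.adjoint_inner_left]
  -- Both sides of the pairing are continuous linear functionals of `z`, so simple tensors suffice
  -- for `z` too.
  have : (innerSL ℂ (tmul x y)) ∘L mapT A B = innerSL ℂ (mapT A.adjoint B.adjoint (tmul x y)) :=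
    semilinear_ext_tmul fun a b => by
      simp [mapT_tmul, inner_tmul, ContinuousLinearMap.adjoint_inner_left]
  exact congrArg (fun f => f z) this

end HilbertTensor

section RealStructure

variable {H : Type*} [NormedAddCommGroup H] [InnerProductSpace ℂ H]

theorem opS_opS (J : H ≃ₗᵢ⋆[ℂ] H) (hJ : ∀ f, J (J f) = f) (f : HTensor H H) :
    opS J (opS J f) = f := by
  have : (opS J).comp (opS J) = ContinuousLinearMap.id ℂ (HTensor H H) :=
    semilinear_ext_tmul fun x y => by simp [opS_tmul, hJ]
  exact congrArg (fun A => A f) this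

end RealStructure

/-! ### Operators on leading and trailing tensor factors -/

section Powers

variable {H : Type u} [NormedAddCommGroup H] [InnerProductSpace ℂ H]

theorem cons_ext {G : Type*} [NormedAddCommGroup G] [InnerProductSpace ℂ G] {n : ℕ}
    {A B : HPow H (n + 1) →L[ℂ] G}
    (h : ∀ x y, A (cons H n (tmul x y)) = B (cons H n (tmul x y))) : A = B := by
  have : A ∘L (cons H n).toContinuousLinearEquiv.toContinuousLinearMap =
      B ∘L (cons H n).toContinuousLinearEquiv.toContinuousLinearMap :=
    semilinear_ext_tmul h
  ext z
  have := congrArg (fun C => C ((cons H n).symm z)) this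
  simpa using this

theorem cons2_ext {G : Type*} [NormedAddCommGroup G] [InnerProductSpace ℂ G] {n : ℕ}
    {A B : HPow H (n + 2) →L[ℂ] G}
    (h : ∀ f x, A (cons2 H n (tmul f x)) = B (cons2 H n (tmul f x))) : A = B := by
  have : A ∘L (cons2 H n).toContinuousLinearEquiv.toContinuousLinearMap =
      B ∘L (cons2 H n).toContinuousLinearEquiv.toContinuousLinearMap :=
    semilinear_ext_tmul h
  ext z
  have := congrArg (fun C => C ((cons2 H n).symm z)) this
  simpa using this

theorem onFirst_cons (n : ℕ) (A : H →L[ℂ] H) (x : H) (y : HPow H n) :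
    onFirst n A (cons H n (tmul x y)) = cons H n (tmul (A x) y) := by
  simp [onFirst, mapT_tmul]

theorem onTail_cons {n : ℕ} (A : HPow H n →L[ℂ] HPow H n) (x : H) (y : HPow H n) :
    onTail A (cons H n (tmul x y)) = cons H n (tmul x (A y)) := by
  simp [onTail, mapT_tmul]

theorem onHead_cons2 (n : ℕ) (A : HTensor H H →L[ℂ] HTensor H H) (f : HTensor H H)
    (x : HPow H n) :
    onHead n A (cons2 H n (tmul f x)) = cons2 H n (tmul (A f) x) := by
  simp [onHead, mapT_tmul]

theorem onTail_mul {n : ℕ} (A B : HPow H n →L[ℂ] HPow H n) :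
    onTail (A * B) = onTail A * onTail B :=
  cons_ext fun x y => by simp [onTail_cons]

theorem onTail_one {n : ℕ} : onTail (1 : HPow H n →L[ℂ] HPow H n) = 1 :=
  cons_ext fun x y => by simp [onTail_cons]

theorem onTail_add {n : ℕ} (A B : HPow H n →L[ℂ] HPow H n) :
    onTail (A + B) = onTail A + onTail B :=
  cons_ext fun x y => by simp [onTail_cons]

variable (H) in
/-- `A ↦ 1 ⊗ A` as a homomorphism of rings. -/
noncomputable def onTailHom (n : ℕ) :
    (HPow H n →L[ℂ] HPow H n) →+* (HPow H (n + 1) →L[ℂ] HPow H (n + 1)) where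
  toFun := onTail
  map_one' := onTail_one
  map_mul' := onTail_mul
  map_zero' := cons_ext fun x y => by simp [onTail_cons]
  map_add' := onTail_add

theorem onTailHom_apply {n : ℕ} (A : HPow H n →L[ℂ] HPow H n) : onTailHom H n A = onTail A := rfl

/-- The two operators act on disjoint tensor factors; `key` transports `1 ⊗ 1 ⊗ B` through the
associator. -/
theorem onHead_mul_onTail_onTail {n : ℕ} (A : HTensor H H →L[ℂ] HTensor H H)
    (B : HPow H n →L[ℂ] HPow H n) :
    onHead n A * onTail (onTail B) = onTail (onTail B) * onHead n A := by
  have key : ∀ f x, onTail (onTail B) (cons2 H n (tmul f x)) = cons2 H n (tmul f (B x)) := by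
    intro f x
    have : onTail (onTail B) ∘L (cons2 H n).toContinuousLinearEquiv.toContinuousLinearMap ∘L
        tmul.flip x =
        (cons2 H n).toContinuousLinearEquiv.toContinuousLinearMap ∘L tmul.flip (B x) :=
      semilinear_ext_tmul fun a b => by simp [cons2_tmul, onTail_cons]
    exact congrArg (fun C => C f) this
  exact cons2_ext fun f x => by simp [key, onHead_cons2]

/-- The braid relation on three factors is carried to the first three factors of a longer power by
the maps `z ↦ z ⊗ w`, which intertwine the operators involved. -/
theorem YangBaxter.onHead {T : HTensor H H →L[ℂ] HTensor H H} (hT : YangBaxter T) (n : ℕ) :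
    onHead (n + 1) T * onTail (TFock.onHead n T) * TFock.onHead (n + 1) T =
      onTail (TFock.onHead n T) * TFock.onHead (n + 1) T * onTail (TFock.onHead n T) := by
  set A : HTensor H (HTensor H H) →L[ℂ] HTensor H (HTensor H H) :=
    (assoc H H H).toContinuousLinearEquiv.toContinuousLinearMap ∘L
      mapT T (ContinuousLinearMap.id ℂ H) ∘L
      (assoc H H H).symm.toContinuousLinearEquiv.toContinuousLinearMap with hA
  set B : HTensor H (HTensor H H) →L[ℂ] HTensor H (HTensor H H) :=
    mapT (ContinuousLinearMap.id ℂ H) T with hB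
  have hAB : A ∘L B ∘L A = B ∘L A ∘L B := hT
  -- `φ w` is `z ↦ z ⊗ w`, bracketed for `1 ⊗ T`; `hφa` describes it in the bracketing suited to `T
  -- ⊗ 1`.
  let φ : HPow H n → HTensor H (HTensor H H) →L[ℂ] HPow H (n + 3) := fun w =>
    (cons H (n + 2)).toContinuousLinearEquiv.toContinuousLinearMap ∘L
      mapT (ContinuousLinearMap.id ℂ H)
        ((cons2 H n).toContinuousLinearEquiv.toContinuousLinearMap ∘L tmul.flip w)
  have hφ : ∀ w x F, φ w (tmul x F) = cons H (n + 2) (tmul x (cons2 H n (tmul F w))) := by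
    intro w x F
    simp [φ, mapT_tmul]
  have hφB : ∀ w z, onTail (TFock.onHead n T) (φ w z) = φ w (B z) := by
    intro w z
    have : onTail (TFock.onHead n T) ∘L φ w = φ w ∘L B :=
      semilinear_ext_tmul fun x F => by simp [hφ, hB, mapT_tmul, onTail_cons, onHead_cons2]
    exact congrArg (fun C => C z) this
  have hφa : ∀ w F z, φ w (assoc H H H (tmul F z)) =
      cons2 H (n + 1) (tmul F (cons H n (tmul z w))) := by
    intro w F z
    have : φ w ∘L (assoc H H H).toContinuousLinearEquiv.toContinuousLinearMap ∘L tmul.flip z =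
        (cons2 H (n + 1)).toContinuousLinearEquiv.toContinuousLinearMap ∘L
          tmul.flip (cons H n (tmul z w)) :=
      semilinear_ext_tmul fun x y => by simp [assoc_tmul, hφ, cons2_tmul]
    exact congrArg (fun C => C F) this
  have hφA : ∀ w z, TFock.onHead (n + 1) T (φ w z) = φ w (A z) := by
    intro w z
    have : (TFock.onHead (n + 1) T ∘L φ w) ∘L
        (assoc H H H).toContinuousLinearEquiv.toContinuousLinearMap =
        (φ w ∘L A) ∘L (assoc H H H).toContinuousLinearEquiv.toContinuousLinearMap :=
      semilinear_ext_tmul fun F z => by simp [hA, hφa, mapT_tmul, onHead_cons2]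
    have := congrArg (fun C => C ((assoc H H H).symm z)) this
    simpa using this
  refine cons2_ext fun F v => ?_
  -- The remaining vector `v` may be taken of the form `z ⊗ w`, which puts the argument in the range
  -- of `φ w`.
  have hv : ∀ C D : HPow H (n + 3) →L[ℂ] HPow H (n + 3),
      (∀ z w, C (cons2 H (n + 1) (tmul F (cons H n (tmul z w)))) =
        D (cons2 H (n + 1) (tmul F (cons H n (tmul z w))))) →
      C (cons2 H (n + 1) (tmul F v)) = D (cons2 H (n + 1) (tmul F v)) := by
    intro C D h
    have : C ∘L (cons2 H (n + 1)).toContinuousLinearEquiv.toContinuousLinearMap ∘L tmul F =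
      D ∘L (cons2 H (n + 1)).toContinuousLinearEquiv.toContinuousLinearMap ∘L tmul F :=
      cons_ext h
    exact congrArg (fun C => C v) this
  refine hv _ _ fun z w => ?_
  rw [← hφa]
  simp only [mul_apply_eq_comp, hφA, hφB]
  exact congrArg (fun C => φ w (C (assoc H H H (tmul F z)))) hAB

theorem onTail_adjoint [CompleteSpace H] {n : ℕ} (A : HPow H n →L[ℂ] HPow H n) :
    star (onTail A) = onTail (star A) := by
  simp only [onTail, ContinuousLinearMap.star_eq_adjoint]
  rw [ContinuousLinearMap.adjoint_comp, ContinuousLinearMap.adjoint_comp, mapT_adjoint]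
  have h1 : (cons H n).toContinuousLinearEquiv.toContinuousLinearMap.adjoint =
    (cons H n).symm.toContinuousLinearEquiv.toContinuousLinearMap :=
      LinearIsometryEquiv.adjoint_eq_symm (cons H n)
  have h2 : (cons H n).symm.toContinuousLinearEquiv.toContinuousLinearMap.adjoint =
    (cons H n).toContinuousLinearEquiv.toContinuousLinearMap :=
      LinearIsometryEquiv.adjoint_eq_symm (cons H n).symm
  rw [h1, h2, ContinuousLinearMap.adjoint_id]
  rfl

theorem onHead_adjoint (n : ℕ) (A : HTensor H H →L[ℂ] HTensor H H) :
    star (onHead n A) = onHead n (star A) := by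
  simp only [onHead, ContinuousLinearMap.star_eq_adjoint]
  rw [ContinuousLinearMap.adjoint_comp, ContinuousLinearMap.adjoint_comp, mapT_adjoint]
  have h1 : (cons2 H n).toContinuousLinearEquiv.toContinuousLinearMap.adjoint =
    (cons2 H n).symm.toContinuousLinearEquiv.toContinuousLinearMap :=
      LinearIsometryEquiv.adjoint_eq_symm (cons2 H n)
  have h2 : (cons2 H n).symm.toContinuousLinearEquiv.toContinuousLinearMap.adjoint =
    (cons2 H n).toContinuousLinearEquiv.toContinuousLinearMap :=
      LinearIsometryEquiv.adjoint_eq_symm (cons2 H n).symm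
  rw [h1, h2, ContinuousLinearMap.adjoint_id]
  rfl

/-! ### Recursions for `𝕋ₙ` and `𝒫ₙ` -/

variable (T : HTensor H H →L[ℂ] HTensor H H)

theorem leg_succ (n i : ℕ) : leg T (n + 1) (i + 1) = onTail (leg T n i) := by
  cases n with
  | zero => exact onTail_one.symm
  | succ n => rfl

theorem prod_map_leg_succ (n : ℕ) (w : List ℕ) :
    ((w.map Nat.succ).map (leg T (n + 1))).prod = onTail ((w.map (leg T n)).prod) := by
  rw [← onTailHom_apply, map_list_prod, List.map_map, List.map_map]
  congr 2
  ext1 i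
  exact leg_succ T n i

theorem opR_one : opR T 1 = 1 := by simp [opR]

/-- Every summand except `1` begins with `T₁`, and what follows is a word in `T₂, T₃, …`, a shifted
summand of `𝕋ₙ₊₁`. -/
theorem opR_succ_succ (n : ℕ) :
    opR T (n + 2) = 1 + onHead n T * onTail (opR T (n + 1)) := by
  rw [opR, Finset.sum_range_succ']
  refine (add_comm _ _).trans ?_
  congr 1
  · rw [opR, ← onTailHom_apply, map_sum, Finset.mul_sum]
    refine Finset.sum_congr rfl fun k _ => ?_
    rw [List.range_succ_eq_map, List.map_cons, List.prod_cons, prod_map_leg_succ]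
    rfl

theorem permOp_succ {n : ℕ} (σ : Equiv.Perm (Fin (n + 1))) :
    permOp T σ = onTail (permOp T (redPart σ)) *
      ((List.range (σ⁻¹ 0 : Fin (n + 1))).map (leg T (n + 1))).prod := by
  rw [permOp, permOp, redWord, List.map_append, List.prod_append, prod_map_leg_succ]
  rfl

/-- The cycles `(0 1 ⋯ k)` represent the right cosets of the stabilizer of `0`. Injectivity recovers
`σ` from its two factors; surjectivity is the count `(n + 1)! = (n + 1) · n!`. -/
theorem bijective_redPart (n : ℕ) :
    Function.Bijective fun σ : Equiv.Perm (Fin (n + 1)) => (redPart σ, σ⁻¹ 0) := by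
  rw [Fintype.bijective_iff_injective_and_card]
  refine ⟨fun σ τ h => ?_, ?_⟩
  · simp only [Prod.mk.injEq] at h
    have h1 := decomposeFin_redPart σ
    have h2 := decomposeFin_redPart τ
    rw [← h.1, ← h.2, h1] at h2
    exact mul_right_cancel h2
  · simp [Fintype.card_perm, Nat.factorial_succ, mul_comm]

theorem opP_zero : opP T 0 = 1 := by
  simp [opP, permOp, redWord]

/-- In the coset parametrization `T_σ` is a product of a factor depending on the stabilizer part and
one depending on `k`, so the sum factors. -/
theorem opP_succ (n : ℕ) : opP T (n + 1) = onTail (opP T n) * opR T (n + 1) := by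
  calc opP T (n + 1) = ∑ p : Equiv.Perm (Fin n) × Fin (n + 1),
        onTail (permOp T p.1) * ((List.range p.2).map (leg T (n + 1))).prod :=
      Fintype.sum_bijective _ (bijective_redPart n) _ _ (permOp_succ T)
    _ = _ := by
      rw [Fintype.sum_prod_type, opP, opR, ← onTailHom_apply, map_sum, Finset.sum_mul]
      refine Finset.sum_congr rfl fun σ _ => ?_
      rw [Finset.sum_range, Finset.mul_sum]
      rfl

theorem opP_one : opP T 1 = 1 := by
  rw [opP_succ, opP_zero, opR_one, onTail_one, one_mul]

theorem opP_succ_succ (n : ℕ) :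
    opP T (n + 2) = onTail (onTail (opP T n)) * onTail (opR T (n + 1)) * opR T (n + 2) := by
  rw [opP_succ, opP_succ, onTail_mul]

/-! ### Self-adjointness of `𝒫ₙ` and the factor `1 + T₁` -/

variable {T}

theorem isSelfAdjoint_opP [CompleteSpace H] (hT : IsSelfAdjoint T) (n : ℕ) :
    IsSelfAdjoint (opP T n) := by
  induction n using Nat.twoStepInduction with
  | zero => rw [opP_zero]; exact IsSelfAdjoint.one _
  | one => rw [opP_one]; exact IsSelfAdjoint.one _
  | more n ih0 ih1 =>
    have h1 : opP T (n + 1) = star (opR T (n + 1)) * onTail (opP T n) := by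
      rw [← ih1.star_eq, opP_succ, star_mul, onTail_adjoint, ih0.star_eq]
    rw [opP_succ, opR_succ_succ]
    refine isSelfAdjoint_mul_one_add (b := onTail (onTail (opP T n))) ?_ ?_ ?_ ?_ ?_
    · rw [isSelfAdjoint_iff, onTail_adjoint, ih1.star_eq]
    · rw [opP_succ, onTail_mul]
    · rw [h1, onTail_mul, onTail_adjoint]
    · rw [isSelfAdjoint_iff, onHead_adjoint, hT.star_eq]
    · exact onHead_mul_onTail_onTail T (opP T n)

/-- Expanding both recursions and moving `1 ⊗ 1 ⊗ 𝕋ₙ₊₁` past `T₁` exposes the shifted induction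
hypothesis `(1 + T₂)(1 ⊗ Y)` behind `T₂ T₁`. Then `T₂T₁ + T₂T₁T₂ = (1 + T₁) T₂T₁` by the braid
relation, which also dictates the witness. -/
theorem exists_onTail_opR_mul_opR (hYB : YangBaxter T) (n : ℕ) :
    ∃ Y, onTail (opR T (n + 1)) * opR T (n + 2) = (1 + onHead n T) * Y := by
  induction n with
  | zero => exact ⟨1, by rw [opR_succ_succ, opR_one, onTail_one]; simp⟩
  | succ n ih =>
    obtain ⟨Y, hY⟩ := ih
    refine ⟨onTail (opR T (n + 2)) + onTail (onHead n T) * onHead (n + 1) T * onTail Y, ?_⟩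
    have hc := onHead_mul_onTail_onTail T (opR T (n + 1))
    have hs := congrArg onTail hY
    rw [onTail_mul, onTail_mul, onTail_add, onTail_one] at hs
    have hR : onTail (opR T (n + 2)) =
        1 + onTail (onHead n T) * onTail (onTail (opR T (n + 1))) := by
      rw [opR_succ_succ T n, onTail_add, onTail_mul, onTail_one]
    rw [opR_succ_succ T (n + 1)]
    have hyb := hYB.onHead n
    calc onTail (opR T (n + 2)) * (1 + onHead (n + 1) T * onTail (opR T (n + 2)))
        = onTail (opR T (n + 2)) + onHead (n + 1) T * onTail (opR T (n + 2)) +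
          onTail (onHead n T) * (onTail (onTail (opR T (n + 1))) * onHead (n + 1) T) *
            onTail (opR T (n + 2)) := by
          rw [mul_add, ← mul_assoc]
          nth_rewrite 2 [hR]
          noncomm_ring
      _ = onTail (opR T (n + 2)) + onHead (n + 1) T * onTail (opR T (n + 2)) +
          onTail (onHead n T) * onHead (n + 1) T *
            (onTail (onTail (opR T (n + 1))) * onTail (opR T (n + 2))) := by
          rw [← hc]; noncomm_ring
      _ = onTail (opR T (n + 2)) + onHead (n + 1) T * onTail (opR T (n + 2)) +
          onTail (onHead n T) * onHead (n + 1) T * onTail Y +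
          onTail (onHead n T) * onHead (n + 1) T * onTail (onHead n T) * onTail Y := by
          rw [hs]; noncomm_ring
      _ = _ := by rw [← hyb]; noncomm_ring

/-- The factor `1 + T₁` first appears on the left, since `1 ⊗ 1 ⊗ 𝒫ₙ` commutes with it; taking
adjoints moves it to the right, where it meets `f ⊗ g`. -/
theorem exists_opP_eq_mul [CompleteSpace H] (hT : IsSelfAdjoint T) (hYB : YangBaxter T) (n : ℕ) :
    ∃ Z, opP T (n + 2) = Z * (1 + onHead n T) := by
  obtain ⟨Y, hY⟩ := exists_onTail_opR_mul_opR hYB n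
  have hc := onHead_mul_onTail_onTail T (opP T n)
  have h : opP T (n + 2) = (1 + onHead n T) * (onTail (onTail (opP T n)) * Y) := by
    rw [opP_succ_succ, mul_assoc, hY, ← mul_assoc, ← mul_assoc, add_mul, hc]
    noncomm_ring
  refine ⟨star (onTail (onTail (opP T n)) * Y), ?_⟩
  rw [← (isSelfAdjoint_opP hT (n + 2)).star_eq, h, star_mul, star_add, star_one, onHead_adjoint,
    hT.star_eq]

end Powers

/-- Real parts agree by polarization; replacing `a` by `i a`, which `J` sends to `-i J a`, gives the
imaginary parts with a sign. -/
theorem inner_map_conj {H : Type*} [NormedAddCommGroup H] [InnerProductSpace ℂ H]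
    (J : H ≃ₗᵢ⋆[ℂ] H) (a b : H) : inner ℂ (J a) (J b) = conj (inner ℂ a b) := by
  have h1 : ∀ a b : H, (inner ℂ (J a) (J b)).re = (inner ℂ a b : ℂ).re := by
    intro a b
    have e1 := norm_add_sq (𝕜 := ℂ) a b
    have e2 := norm_add_sq (𝕜 := ℂ) (J a) (J b)
    rw [← map_add, J.norm_map, J.norm_map, J.norm_map] at e2
    have : RCLike.re (inner ℂ (J a) (J b)) = RCLike.re (inner ℂ a b : ℂ) := by linarith
    exact this
  apply Complex.ext
  · rw [h1, Complex.conj_re]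
  · have := h1 (Complex.I • a) b
    rw [J.map_smulₛₗ, inner_smul_left, inner_smul_left] at this
    simp at this
    rw [Complex.conj_im]
    linarith

/-! ### Creation and annihilation on the full Fock space -/

section FullFock

variable {H : Type u} [NormedAddCommGroup H] [InnerProductSpace ℂ H]

theorem lPlus_apply (f : H) (n : ℕ) (x : HPow H n) : lPlus f n x = cons H n (tmul f x) := rfl

theorem lPP_apply (f : HTensor H H) (n : ℕ) (x : HPow H n) :
    lPP f n x = cons2 H n (tmul f x) := rfl

theorem onHead_lPP (A : HTensor H H →L[ℂ] HTensor H H) (f : HTensor H H) (n : ℕ)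
    (x : HPow H n) : onHead n A (lPP f n x) = lPP (A f) n x := by
  rw [lPP_apply, lPP_apply, onHead_cons2]

theorem onTail_lPlus {n : ℕ} (A : HPow H n →L[ℂ] HPow H n) (f : H) (x : HPow H n) :
    onTail A (lPlus f n x) = lPlus f n (A x) := by
  rw [lPlus_apply, lPlus_apply, onTail_cons]

theorem onTail_onTail_lPP {n : ℕ} (A : HPow H n →L[ℂ] HPow H n) (f : HTensor H H)
    (x : HPow H n) : onTail (onTail A) (lPP f n x) = lPP f n (A x) := by
  have : onTail (onTail A) ∘L (cons2 H n).toContinuousLinearEquiv.toContinuousLinearMap ∘L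
      tmul.flip x =
      (cons2 H n).toContinuousLinearEquiv.toContinuousLinearMap ∘L tmul.flip (A x) :=
    semilinear_ext_tmul fun a b => by simp [cons2_tmul, onTail_cons]
  exact congrArg (fun C => C f) this

theorem add_lPP (f g : HTensor H H) (n : ℕ) (x : HPow H n) :
    lPP (f + g) n x = lPP f n x + lPP g n x := by
  simp [lPP_apply]

theorem lPP_sub (f g : HTensor H H) (n : ℕ) : lPP (f - g) n = lPP f n - lPP g n := by
  ext x
  simp [lPP_apply]

theorem lMM_sub (J : H ≃ₗᵢ⋆[ℂ] H) (f g : HTensor H H) (n : ℕ) :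
    lMM J (f - g) n = lMM J f n - lMM J g n := by
  simp only [lMM, map_sub, lPP_sub]

theorem adjoint_lPlus_lPlus (f g : H) (n : ℕ) (x : HPow H n) :
    (lPlus f n).adjoint (lPlus g n x) = inner ℂ f g • x := by
  refine ext_inner_left ℂ fun y => ?_
  rw [ContinuousLinearMap.adjoint_inner_right, lPlus_apply, lPlus_apply,
    LinearIsometryEquiv.inner_map_map, inner_tmul, inner_smul_right]

variable [CompleteSpace H]

theorem adjoint_lPlus_onTail {n : ℕ} (A : HPow H n →L[ℂ] HPow H n) (f : H)
    (x : HPow H (n + 1)) :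
    (lPlus f n).adjoint (onTail A x) = A ((lPlus f n).adjoint x) := by
  refine ext_inner_left ℂ fun y => ?_
  rw [ContinuousLinearMap.adjoint_inner_right, ← ContinuousLinearMap.adjoint_inner_left,
    ← ContinuousLinearMap.star_eq_adjoint, onTail_adjoint, onTail_lPlus,
    ← ContinuousLinearMap.adjoint_inner_right, ContinuousLinearMap.star_eq_adjoint,
    ContinuousLinearMap.adjoint_inner_left]

theorem lMM_onTail_onTail (J : H ≃ₗᵢ⋆[ℂ] H) {n : ℕ} (A : HPow H n →L[ℂ] HPow H n)
    (f : HTensor H H) (x : HPow H (n + 2)) :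
    lMM J f n (onTail (onTail A) x) = A (lMM J f n x) := by
  refine ext_inner_left ℂ fun y => ?_
  rw [lMM, ContinuousLinearMap.adjoint_inner_right, ← ContinuousLinearMap.adjoint_inner_left,
    ← ContinuousLinearMap.star_eq_adjoint, onTail_adjoint, onTail_adjoint, onTail_onTail_lPP,
    ← ContinuousLinearMap.adjoint_inner_right, ContinuousLinearMap.star_eq_adjoint,
    ContinuousLinearMap.adjoint_inner_left]

theorem inner_slice (J : H ≃ₗᵢ⋆[ℂ] H) (hJ : ∀ f, J (J f) = f) (f : HTensor H H) (g u : H) :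
    inner ℂ u (slice J f g) = bil (conj2 J) f (tmul (J u) g) := by
  have : slice J f g = ContinuousLinearMap.adjoint ((tmul (E := H) (F := H)).flip (J g)) f := rfl
  rw [this, ContinuousLinearMap.adjoint_inner_right, ContinuousLinearMap.flip_apply, bil,
    conj2_tmul, hJ]

/-- Both operators act on the first factor only, so it suffices to compare the vectors obtained
there from `h`; their matrix coefficients are the two sides of the definition of `T̃`. -/
theorem adjoint_lPlus_onHead (J : H ≃ₗᵢ⋆[ℂ] H) (hJ : ∀ f, J (J f) = f)
    {T Tt : HTensor H H →L[ℂ] HTensor H H} (hTt : IsTilde J T Tt) (f g : H) (n : ℕ)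
    (x : HPow H (n + 1)) :
    (lPlus (J f) (n + 1)).adjoint (onHead n T (lPlus g (n + 1) x)) =
      lPM J (Tt (tmul f g)) n x := by
  have key : (lPlus (J f) (n + 1)).adjoint ∘L onHead n T ∘L lPlus g (n + 1) =
      lPM J (Tt (tmul f g)) n := by
    refine cons_ext fun h y => ?_
    have h1 : ∀ F : HTensor H H, (lPlus (J f) (n + 1)).adjoint (lPP F n y) =
        lPlus (ContinuousLinearMap.adjoint (tmul (J f)) F) n y := by
      intro F
      have : (lPlus (J f) (n + 1)).adjoint ∘L
          (cons2 H n).toContinuousLinearEquiv.toContinuousLinearMap ∘L tmul.flip y =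
          (cons H n).toContinuousLinearEquiv.toContinuousLinearMap ∘L tmul.flip y ∘L
            ContinuousLinearMap.adjoint (tmul (J f)) := by
        refine semilinear_ext_tmul fun a b => ?_
        have h2 : ContinuousLinearMap.adjoint (tmul (J f)) (tmul a b) = inner ℂ (J f) a • b := by
          refine ext_inner_left ℂ fun y => ?_
          rw [ContinuousLinearMap.adjoint_inner_right, inner_tmul, inner_smul_right]
        have h3 := adjoint_lPlus_lPlus (J f) a (n + 1) (lPlus b n y)
        rw [← lPP_tmul] at h3
        simp only [ContinuousLinearMap.comp_apply, ContinuousLinearMap.flip_apply, h2, map_smul]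
        exact h3
      exact congrArg (fun C => C F) this
    have h2 : lPlus g (n + 1) (cons H n (tmul h y)) = lPP (tmul g h) n y := (lPP_tmul g h n y).symm
    rw [ContinuousLinearMap.comp_apply, ContinuousLinearMap.comp_apply, h2, onHead_lPP, h1, lPM,
      onFirst_cons, lPlus_apply]
    congr 3
    refine ext_inner_left ℂ fun u => ?_
    -- The identity for `T̃` is used with `f₁ = g`, `f₂ = h`, `f₃ = f`, `f₄ = J u`.
    rw [ContinuousLinearMap.adjoint_inner_right, inner_slice J hJ, ← hTt, bil, conj2_tmul, hJ]
  exact congrArg (fun C => C x) key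

end FullFock

/-! ### Graded operators and the deformed inner product -/

section Fock

variable {H : Type u} [NormedAddCommGroup H] [InnerProductSpace ℂ H]
  {T : HTensor H H →L[ℂ] HTensor H H}

theorem gradedOp_lof (d : ℕ → ℕ) (A : (n : ℕ) → nParticle T n →ₗ[ℂ] nParticle T (d n)) (n : ℕ)
    (x : nParticle T n) :
    gradedOp T d A (DirectSum.lof ℂ ℕ (fun n => nParticle T n) n x) =
      DirectSum.lof ℂ ℕ (fun n => nParticle T n) (d n) (A n x) := by
  simp [gradedOp]

theorem gradedOp_eq_zero_iff (d : ℕ → ℕ) (A : (n : ℕ) → nParticle T n →ₗ[ℂ] nParticle T (d n)) :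
    gradedOp T d A = 0 ↔ ∀ n, A n = 0 := by
  refine ⟨fun h n => LinearMap.ext fun x => ?_, fun h => ?_⟩
  · have h1 := gradedOp_lof d A n x
    rw [h] at h1
    exact DirectSum.of_injective (β := fun n => nParticle T n) _ (h1.symm.trans (map_zero _).symm)
  · refine DirectSum.linearMap_ext ℂ fun n => LinearMap.ext fun x => ?_
    rw [LinearMap.comp_apply, gradedOp_lof, h]
    simp

theorem gradedOp_sub (d : ℕ → ℕ) (A B : (n : ℕ) → nParticle T n →ₗ[ℂ] nParticle T (d n)) :
    gradedOp T d A - gradedOp T d B = gradedOp T d fun n => A n - B n := by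
  refine DirectSum.linearMap_ext ℂ fun n => LinearMap.ext fun x => ?_
  simp only [LinearMap.comp_apply, LinearMap.sub_apply, gradedOp_lof, map_sub]

theorem aPP_sub (f g : HTensor H H) : aPP T (f - g) = aPP T f - aPP T g := by
  rw [aPP, aPP, aPP, gradedOp_sub]
  congr 1
  funext n
  ext x
  simp [lPP_sub]

theorem aMM_sub (J : H ≃ₗᵢ⋆[ℂ] H) (f g : HTensor H H) :
    aMM J T (f - g) = aMM J T f - aMM J T g := by
  rw [aMM, aMM, aMM, gradedOp_sub]
  congr 1
  funext n
  match n with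
  | 0 => simp
  | 1 => simp
  | n + 2 => ext x; simp [lMM_sub]

theorem fockInner_lof_right (x : FockFin T) (n : ℕ) (y : nParticle T n) :
    fockInner T x (DirectSum.lof ℂ ℕ (fun n => nParticle T n) n y) =
      inner ℂ (x n : HPow H n) (opP T n y) := by
  classical
  exact DFinsupp.sum_single_index (by simp)

theorem fockInner_add_right (x y z : FockFin T) :
    fockInner T x (y + z) = fockInner T x y + fockInner T x z := by
  classical
  exact DFinsupp.sum_add_index (by simp) (by simp)

theorem fockInner_zero_right (x : FockFin T) : fockInner T x 0 = 0 := by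
  classical
  exact DFinsupp.sum_zero_index

theorem fockInner_add_left (x y z : FockFin T) :
    fockInner T (x + y) z = fockInner T x z + fockInner T y z := by
  classical
  simp only [fockInner, DirectSum.add_apply, Submodule.coe_add, inner_add_left]
  exact DFinsupp.sum_add

theorem fockInner_zero_left (x : FockFin T) : fockInner T 0 x = 0 := by
  classical
  simp [fockInner, DFinsupp.sum]

theorem isFockAdjoint_of_lof {A B : FockFin T →ₗ[ℂ] FockFin T}
    (h : ∀ m (a : nParticle T m) n (b : nParticle T n),
      fockInner T (A (DirectSum.lof ℂ ℕ (fun n => nParticle T n) m a))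
        (DirectSum.lof ℂ ℕ (fun n => nParticle T n) n b) =
      fockInner T (DirectSum.lof ℂ ℕ (fun n => nParticle T n) m a)
        (B (DirectSum.lof ℂ ℕ (fun n => nParticle T n) n b))) : IsFockAdjoint T A B := by
  intro x y
  induction x using DirectSum.induction_on with
  | zero => simp [fockInner_zero_left]
  | add x x' hx hx' => rw [map_add, fockInner_add_left, fockInner_add_left, hx, hx']
  | of m a =>
    induction y using DirectSum.induction_on with
    | zero => simp [fockInner_zero_right]
    | add y y' hy hy' => rw [map_add, fockInner_add_right, fockInner_add_right, hy, hy']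
    | of n b => exact h m a n b

theorem opP_eq_zero_iff {n : ℕ} (x : nParticle T n) : opP T n x = 0 ↔ x = 0 := by
  refine ⟨fun h => ?_, fun h => by simp [h]⟩
  exact Subtype.ext (Submodule.disjoint_def.1 (Submodule.orthogonal_disjoint (opP T n).ker) x h x.2)

/-- The kernel of `ℙₙ` is `(ker 𝒫ₙ)ᗮᗮ`, and `ker 𝒫ₙ` is closed. Equalities after `ℙₙ` can thus be
tested with `𝒫ₙ`. -/
theorem proj_eq_zero_iff {n : ℕ} (x : HPow H n) : proj T n x = 0 ↔ opP T n x = 0 := by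
  rw [proj, Submodule.orthogonalProjectionOnto_eq_zero_iff, nParticle,
    Submodule.orthogonal_orthogonal_eq_closure,
    (ContinuousLinearMap.isClosed_ker (opP T n)).submodule_topologicalClosure_eq]
  exact LinearMap.mem_ker

theorem opP_proj {n : ℕ} (x : HPow H n) : opP T n (proj T n x) = opP T n x := by
  rw [← sub_eq_zero, ← map_sub, ← proj_eq_zero_iff, map_sub, sub_eq_zero]
  exact Submodule.orthogonalProjectionOnto_mem_subspace_eq_self _

variable [CompleteSpace H]

theorem inner_opP (hT : IsSelfAdjoint T) {n : ℕ} (x y : HPow H n) :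
    inner ℂ (opP T n x) y = inner ℂ x (opP T n y) := by
  rw [← ContinuousLinearMap.adjoint_inner_left, ← ContinuousLinearMap.star_eq_adjoint,
    (isSelfAdjoint_opP hT n).star_eq]

theorem inner_proj_opP (hT : IsSelfAdjoint T) {n : ℕ} (x y : HPow H n) :
    inner ℂ (proj T n x : HPow H n) (opP T n y) = inner ℂ x (opP T n y) := by
  rw [← inner_opP hT, opP_proj, inner_opP hT]

theorem fockInner_lof_left (hT : IsSelfAdjoint T) (n : ℕ) (x : nParticle T n) (y : FockFin T) :
    fockInner T (DirectSum.lof ℂ ℕ (fun n => nParticle T n) n x) y =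
      inner ℂ (opP T n x) (y n : HPow H n) := by
  induction y using DirectSum.induction_on with
  | zero => simp [fockInner_zero_right]
  | add y y' hy hy' => rw [fockInner_add_right, hy, hy']; simp
  | of m b =>
    rw [← DirectSum.lof_eq_of ℂ, fockInner_lof_right]
    by_cases h : n = m
    · subst h
      rw [DirectSum.lof_apply, DirectSum.lof_apply, inner_opP hT]
    · rw [DirectSum.lof_eq_of, DirectSum.lof_eq_of, DirectSum.of_eq_of_ne _ _ _ (Ne.symm h),
        DirectSum.of_eq_of_ne _ _ _ h]
      simp

/-- Testing against `ℙₙ z` amounts to testing `𝒫ₙ y⁽ⁿ⁾` against every `z`, and `𝒫ₙ` is injective on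
`ℱₙ(H)`. -/
theorem eq_zero_of_fockInner_right (hT : IsSelfAdjoint T) {y : FockFin T}
    (h : ∀ x, fockInner T x y = 0) : y = 0 := by
  refine DFinsupp.ext fun n => (opP_eq_zero_iff _).1 (ext_inner_left ℂ fun z => ?_)
  have := h (DirectSum.lof ℂ ℕ (fun n => nParticle T n) n (proj T n z))
  rw [fockInner_lof_left hT, inner_opP hT, inner_proj_opP hT] at this
  rw [this, inner_zero_right]

theorem eq_zero_of_fockInner_left (hT : IsSelfAdjoint T) {x : FockFin T}
    (h : ∀ y, fockInner T x y = 0) : x = 0 := by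
  refine DFinsupp.ext fun n => (opP_eq_zero_iff _).1 (ext_inner_right ℂ fun z => ?_)
  have := h (DirectSum.lof ℂ ℕ (fun n => nParticle T n) n (proj T n z))
  rw [fockInner_lof_right, opP_proj, ← inner_opP hT] at this
  rw [this, inner_zero_left]

theorem IsFockAdjoint.unique (hT : IsSelfAdjoint T) {A B B' : FockFin T →ₗ[ℂ] FockFin T}
    (h : IsFockAdjoint T A B) (h' : IsFockAdjoint T A B') : B = B' := by
  refine LinearMap.ext fun y => sub_eq_zero.1 (eq_zero_of_fockInner_right hT fun x => ?_)
  have h1 := fockInner_add_right x (B y - B' y) (B' y)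
  rw [sub_add_cancel, ← h, ← h'] at h1
  exact right_eq_add.1 h1

theorem IsFockAdjoint.eq_zero_iff (hT : IsSelfAdjoint T) {A B : FockFin T →ₗ[ℂ] FockFin T}
    (h : IsFockAdjoint T A B) : A = 0 ↔ B = 0 := by
  constructor
  · rintro rfl
    exact LinearMap.ext fun y => eq_zero_of_fockInner_right hT fun x => by
      rw [← h, LinearMap.zero_apply, fockInner_zero_left]
  · rintro rfl
    exact LinearMap.ext fun x => eq_zero_of_fockInner_left hT fun y => by
      rw [h, LinearMap.zero_apply, fockInner_zero_right]

/-- The annihilation operator by its explicit formula `g⁽ⁿ⁾ ↦ ℙₙ₋₁ l⁺(f)* 𝕋ₙ g⁽ⁿ⁾`. -/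
noncomputable def annihilation (T : HTensor H H →L[ℂ] HTensor H H) (f : H) :
    FockFin T →ₗ[ℂ] FockFin T :=
  gradedOp T (fun n => n - 1) fun
    | 0 => 0
    | n + 1 =>
      (proj T n ∘L (lPlus f n).adjoint ∘L opR T (n + 1) ∘L
        (nParticle T (n + 1)).subtypeL).toLinearMap

/-- With `𝒫ₙ₊₁ = (1 ⊗ 𝒫ₙ) 𝕋ₙ₊₁`, the operator `l⁺(f)*` turns `1 ⊗ 𝒫ₙ` into `𝒫ₙ`, which is the weight
of the form in degree `n`. -/
theorem isFockAdjoint_annihilation (hT : IsSelfAdjoint T) (f : H) :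
    IsFockAdjoint T (aPlus T f) (annihilation T f) := by
  refine isFockAdjoint_of_lof fun m a n b => ?_
  rw [aPlus, annihilation, gradedOp_lof, gradedOp_lof, fockInner_lof_right, fockInner_lof_right]
  match n, b with
  -- The truncated degree `0 - 1 = 0` is harmless: the operator is zero there, and `a⁺(f)` has no
  -- component in degree `0`.
  | 0, b => simp [DirectSum.lof_eq_of, DirectSum.of_eq_of_ne]
  | n + 1, b =>
    by_cases h : m = n
    · subst h
      have ha : (DirectSum.lof ℂ ℕ (fun n => nParticle T n) m a) m = a := by
        rw [DirectSum.lof_apply]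
      rw [DirectSum.lof_apply]
      simp only [ContinuousLinearMap.coe_coe, ContinuousLinearMap.comp_apply,
        Submodule.subtypeL_apply]
      rw [inner_proj_opP hT]
      refine Eq.trans ?_ (congrArg₂ (fun u v : HPow H m => inner ℂ u v)
        (congrArg Subtype.val ha.symm) (opP_proj _).symm)
      rw [← adjoint_lPlus_onTail, ContinuousLinearMap.adjoint_inner_right, opP_succ]
      rfl
    · have h1 : (DirectSum.lof ℂ ℕ (fun n => nParticle T n) m a) n = 0 := by
        rw [DirectSum.lof_eq_of, DirectSum.of_eq_of_ne _ _ _ (Ne.symm h)]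
      rw [DirectSum.lof_eq_of, DirectSum.of_eq_of_ne _ _ _ (by omega)]
      refine Eq.trans ?_ (congrArg (fun u : nParticle T n => inner ℂ (u : HPow H n) _) h1.symm)
      simp

theorem isFockAdjoint_aMM (J : H ≃ₗᵢ⋆[ℂ] H) (hT : IsSelfAdjoint T) (f : HTensor H H) :
    IsFockAdjoint T (aPP T (opS J f)) (aMM J T f) := by
  refine isFockAdjoint_of_lof fun m a n b => ?_
  rw [aPP, aMM, gradedOp_lof, gradedOp_lof, fockInner_lof_right, fockInner_lof_right]
  match n, b with
  | 0, b => simp [DirectSum.lof_eq_of, DirectSum.of_eq_of_ne]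
  | 1, b => simp [DirectSum.lof_eq_of, DirectSum.of_eq_of_ne]
  | n + 2, b =>
    by_cases h : m = n
    · subst h
      have ha : (DirectSum.lof ℂ ℕ (fun n => nParticle T n) m a) m = a := by
        rw [DirectSum.lof_apply]
      rw [DirectSum.lof_apply]
      simp only [ContinuousLinearMap.coe_coe, ContinuousLinearMap.comp_apply,
        Submodule.subtypeL_apply]
      rw [inner_proj_opP hT]
      refine Eq.trans ?_ (congrArg₂ (fun u v : HPow H m => inner ℂ u v)
        (congrArg Subtype.val ha.symm) (opP_proj _).symm)
      rw [← lMM_onTail_onTail, lMM, ContinuousLinearMap.adjoint_inner_right,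
        ← mul_apply_eq_comp (onTail _), ← onTail_mul, opP_succ, mul_apply_eq_comp]
      -- What remains is to insert the inner projection of `a⁻⁻`, which is possible because `𝒫ₘ₊₁
      -- ℙₘ₊₁ = 𝒫ₘ₊₁`.
      congr 3
      ext x
      have := opP_proj (T := T) x
      rw [opP_succ] at this
      exact (congrArg (fun B => B x) (opP_succ T m)).trans this.symm
    · have h1 : (DirectSum.lof ℂ ℕ (fun n => nParticle T n) m a) n = 0 := by
        rw [DirectSum.lof_eq_of, DirectSum.of_eq_of_ne _ _ _ (Ne.symm h)]
      rw [DirectSum.lof_eq_of, DirectSum.of_eq_of_ne _ _ _ (by omega)]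
      refine Eq.trans ?_ (congrArg (fun u : nParticle T n => inner ℂ (u : HPow H n) _) h1.symm)
      simp

/-! ### The commutation relations -/

theorem isFockAdjoint_iff_eq_aMinus (J : H ≃ₗᵢ⋆[ℂ] H) (hT : IsSelfAdjoint T) (f : H)
    (B : FockFin T →ₗ[ℂ] FockFin T) :
    IsFockAdjoint T (aPlus T (J f)) B ↔ B = aMinus J T f := by
  have hex : ∃ B, IsFockAdjoint T (aPlus T (J f)) B := ⟨_, isFockAdjoint_annihilation hT (J f)⟩
  have h : IsFockAdjoint T (aPlus T (J f)) (aMinus J T f) := by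
    rw [aMinus, dif_pos hex]
    exact hex.choose_spec
  exact ⟨fun hB => hB.unique hT h, fun hB => hB ▸ h⟩

theorem aMinus_eq_annihilation (J : H ≃ₗᵢ⋆[ℂ] H) (hT : IsSelfAdjoint T) (f : H) :
    aMinus J T f = annihilation T (J f) :=
  ((isFockAdjoint_iff_eq_aMinus J hT f _).1 (isFockAdjoint_annihilation hT (J f))).symm

/-- Applying `𝒫ₙ` turns `l⁺(f)* 𝕋ₙ₊₁` into `l⁺(f)* 𝒫ₙ₊₁`, which does not see `ℙₙ₊₁`. This removes
the projection contained in `a⁺(g)` from `a⁻(f) a⁺(g)`. -/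
theorem proj_adjoint_lPlus_opR_proj (f : H) (n : ℕ) (x : HPow H (n + 1)) :
    proj T n ((lPlus f n).adjoint (opR T (n + 1) (proj T (n + 1) x))) =
      proj T n ((lPlus f n).adjoint (opR T (n + 1) x)) := by
  rw [← sub_eq_zero, ← map_sub, ← map_sub, ← map_sub, proj_eq_zero_iff, ← adjoint_lPlus_onTail,
    ← mul_apply_eq_comp (onTail _), ← opP_succ, map_sub, opP_proj, sub_self, map_zero]

theorem aMinus_comp_aPlus (J : H ≃ₗᵢ⋆[ℂ] H) (hJ : ∀ f, J (J f) = f) (hT : IsSelfAdjoint T)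
    {Tt : HTensor H H →L[ℂ] HTensor H H} (hTt : IsTilde J T Tt) (f g : H) :
    aMinus J T f ∘ₗ aPlus T g = aPM J T (Tt (tmul f g)) + bil J f g • LinearMap.id := by
  rw [aMinus_eq_annihilation J hT]
  refine DirectSum.linearMap_ext ℂ fun n => LinearMap.ext fun x => ?_
  have hb : inner ℂ (J f) g = bil J f g := by
    rw [bil, ← inner_conj_symm, ← inner_map_conj J, hJ]
  rw [LinearMap.comp_apply, LinearMap.comp_apply, aPlus, annihilation, gradedOp_lof, gradedOp_lof,
    LinearMap.comp_apply, LinearMap.add_apply, aPM, gradedOp_lof, LinearMap.smul_apply,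
    LinearMap.id_apply, ← map_smul, ← map_add]
  refine congrArg (DirectSum.lof ℂ ℕ (fun n => nParticle T n) n) ?_
  refine (proj_adjoint_lPlus_opR_proj (J f) n (lPlus g n x)).trans ?_
  have hx : proj T n (x : HPow H n) = x :=
    Submodule.orthogonalProjectionOnto_mem_subspace_eq_self _
  match n, x, hx with
  | 0, x, hx =>
    rw [opR_one, one_apply_eq_self, adjoint_lPlus_lPlus, map_smul, hx, hb]
    simp
  | n + 1, x, hx =>
    rw [opR_succ_succ, add_apply, one_apply_eq_self, mul_apply_eq_comp, onTail_lPlus,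
      map_add, adjoint_lPlus_lPlus, adjoint_lPlus_onHead J hJ hTt, map_add, map_smul, hx, hb]
    exact add_comm _ _

theorem aPP_eq_zero_iff (hT : IsSelfAdjoint T) (hYB : YangBaxter T) (f : HTensor H H) :
    aPP T f = 0 ↔ f ∈ (1 + T).ker := by
  rw [aPP, gradedOp_eq_zero_iff]
  refine ⟨fun h => ?_, fun h n => LinearMap.ext fun x => ?_⟩
  -- The action on a nonzero multiple of the vacuum suffices: there `𝒫₂ = 1 + T` gives `(f + T f) ⊗
  -- x = 0`.
  · obtain ⟨x, hx⟩ : ∃ x : HPow H 0, x ≠ 0 :=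
      exists_ne (0 : EuclideanSpace ℂ PUnit.{u + 1})
    have hx' : (proj T 0 x : HPow H 0) = x := by simpa [opP_zero] using opP_proj (T := T) x
    have h1 : proj T 2 (lPP f 0 (proj T 0 x : HPow H 0)) = 0 := LinearMap.congr_fun (h 0) _
    rw [hx', proj_eq_zero_iff, opP_succ_succ, opR_succ_succ, opR_one, opP_zero, onTail_one,
      onTail_one, one_mul, one_mul, mul_one, add_apply, one_apply_eq_self, onHead_lPP,
      ← add_lPP] at h1
    have h2 : tmul (f + T f) x = 0 := (map_eq_zero_iff _ (cons2 H 0).injective).1 h1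
    have h3 := inner_tmul (f + T f) (f + T f) x x
    rw [h2, inner_zero_left, eq_comm, mul_eq_zero, inner_self_eq_zero, inner_self_eq_zero] at h3
    exact h3.resolve_right hx
  · obtain ⟨Z, hZ⟩ := exists_opP_eq_mul hT hYB n
    refine (proj_eq_zero_iff _).2 ?_
    have hf : f + T f = 0 := h
    rw [hZ, mul_apply_eq_comp]
    change Z (lPP f n x + onHead n T (lPP f n x)) = 0
    rw [onHead_lPP, ← add_lPP, hf]
    simp [lPP_apply]

theorem aMM_eq_zero_iff (J : H ≃ₗᵢ⋆[ℂ] H) (hT : IsSelfAdjoint T) (hYB : YangBaxter T)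
    (f : HTensor H H) : aMM J T f = 0 ↔ opS J f ∈ (1 + T).ker := by
  rw [← (isFockAdjoint_aMM J hT f).eq_zero_iff hT, aPP_eq_zero_iff hT hYB]

end Fock

section Kernels

variable {M : Type*} [AddCommGroup M] [TopologicalSpace M] [IsTopologicalAddGroup M] [Module ℂ M]
  {T : M →L[ℂ] M} {f h : M}

theorem sub_mem_ker_one_add (hf : f ∈ (1 - T ^ 2).ker) : f - T f ∈ (1 + T).ker := by
  have h1 : f - T (T f) = 0 := hf
  have h2 : (f - T f) + T (f - T f) = f - T (T f) := by rw [map_sub]; abel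
  exact h2.trans h1

theorem mem_ker_one_sub_sq (hh : h ∈ (1 + T).ker) : h ∈ (1 - T ^ 2).ker := by
  have h1 : T h = -h := by rw [← add_eq_zero_iff_eq_neg, add_comm]; exact hh
  change h - T (T h) = 0
  rw [h1, map_neg, h1]
  abel

/-- On `ker (1 + T)` the operator `1 - T` is multiplication by `2`. -/
theorem half_sub_apply_half (hh : h ∈ (1 + T).ker) :
    h = (1 / 2 : ℂ) • h - T ((1 / 2 : ℂ) • h) := by
  have h1 : T h = -h := by rw [← add_eq_zero_iff_eq_neg, add_comm]; exact hh
  rw [map_smul, h1, smul_neg, sub_neg_eq_add, ← add_smul]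
  norm_num

end Kernels

end TFock

/-! ### The theorem -/

open TFock in
theorem theorem2p7 {H : Type u} [NormedAddCommGroup H] [InnerProductSpace ℂ H] [CompleteSpace H]
    [TopologicalSpace.SeparableSpace H]
    (J : H ≃ₗᵢ⋆[ℂ] H) (hJ : ∀ f, J (J f) = f)
    (T : HTensor H H →L[ℂ] HTensor H H) (hT : IsSelfAdjoint T) (hT1 : ‖T‖ ≤ 1)
    (hYB : YangBaxter T) :
    (∀ (f : H) (B : FockFin T →ₗ[ℂ] FockFin T),
      IsFockAdjoint T (aPlus T (J f)) B ↔ B = aMinus J T f) ∧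
    (∀ Tt : HTensor H H →L[ℂ] HTensor H H, IsTilde J T Tt → ∀ f g : H,
      aMinus J T f ∘ₗ aPlus T g = aPM J T (Tt (tmul f g)) + bil J f g • LinearMap.id) ∧
    (∀ f : HTensor H H, aPP T f = 0 ↔ f ∈ (1 + T).ker) ∧
    (∀ f : HTensor H H, aMM J T f = 0 ↔ opS J f ∈ (1 + T).ker) ∧
    (∀ f : HTensor H H, f ∈ (1 - T ^ 2).ker → aPP T f = aPP T (T f)) ∧
    (∀ f : HTensor H H, opS J f ∈ (1 - T ^ 2).ker → aMM J T f = aMM J T (opHat J T f)) ∧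
    (∀ h : HTensor H H, aPP T h = 0 ↔ ∃ f ∈ (1 - T ^ 2).ker, h = f - T f) ∧
    (∀ h : HTensor H H, aMM J T h = 0 ↔
      ∃ f, opS J f ∈ (1 - T ^ 2).ker ∧ h = f - opHat J T f) := by
  -- Since `𝕊² = 1`, `𝕊` intertwines `T̂` with `T`, so each claim on `a⁻⁻` becomes a claim about `𝕊
  -- f` and `T`.
  have hHat : ∀ f, opS J (f - opHat J T f) = opS J f - T (opS J f) := fun f => by
    rw [map_sub]
    exact congrArg _ (opS_opS J hJ _)
  refine ⟨isFockAdjoint_iff_eq_aMinus J hT, fun Tt hTt => aMinus_comp_aPlus J hJ hT hTt,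
    aPP_eq_zero_iff hT hYB, aMM_eq_zero_iff J hT hYB, fun f hf => ?_, fun f hf => ?_,
    fun h => ?_, fun h => ?_⟩
  · rw [← sub_eq_zero, ← aPP_sub, aPP_eq_zero_iff hT hYB]
    exact sub_mem_ker_one_add hf
  · rw [← sub_eq_zero, ← aMM_sub, aMM_eq_zero_iff J hT hYB, hHat]
    exact sub_mem_ker_one_add hf
  · rw [aPP_eq_zero_iff hT hYB]
    constructor
    · exact fun hh => ⟨(1 / 2 : ℂ) • h, Submodule.smul_mem _ _ (mem_ker_one_sub_sq hh),
        half_sub_apply_half hh⟩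
    · rintro ⟨f, hf, rfl⟩
      exact sub_mem_ker_one_add hf
  · rw [aMM_eq_zero_iff J hT hYB]
    constructor
    -- The witness is half of `h`, written so that `𝕊` of it is visibly `½ 𝕊 h`, the witness for
    -- `T`.
    · refine fun hh => ⟨opS J ((1 / 2 : ℂ) • opS J h), ?_, ?_⟩
      · rw [opS_opS J hJ]
        exact Submodule.smul_mem _ _ (mem_ker_one_sub_sq hh)
      · rw [← opS_opS J hJ (_ - _), hHat, opS_opS J hJ, ← half_sub_apply_half hh, opS_opS J hJ]
    · rintro ⟨f, hf, rfl⟩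
      rw [hHat]
      exact sub_mem_ker_one_add hf
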